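/- Let $\mathbb T$ be the unit circle with normalized Lebesgue measure $m$, let $L^2=L^2(\mathbb T,m)$, and let $H^2\subset L^2$ be the Hardy space of functions whose Fourier coefficients of negative index vanish. Let $u$ be a non-constant inner function (that is, $u\in H^2$ and $|u|=1$ a.e. on $\mathbb T$), let $K_u=H^2\ominus uH^2$ be the model space, and let $P_u$ be the orthogonal projection of $L^2$ onto $K_u$. For $\Phi\in L^2$ the truncated Toeplitz operator (TTO) with symbol $\Phi$ is $A_\Phi f=P_u(\Phi f)$, defined on the bounded functions $f\in K_u$ (which are dense in $K_u$). Let $\mathcal T_u$ be the set of TTOs that extend to bounded operators on $K_u$; such a TTO is identified with its extension, and $\Phi$ is called a symbol of $A$ if $A=A_\Phi$. For $f\in K_u$ put $Cf=u\,\overline{zf}\in K_u$ and $S_uf=P_u(zf)$. For $\alpha\in\mathbb C$, an operator $A\in\mathcal T_u$ is said to be of type $\alpha$ if it has a symbol of the form $\varphi+\alpha\,\overline{S_uC\varphi}+c$ with $\varphi\in K_u$ and $c\in\mathbb C$; it is said to be of type $\infty$ if it has an antiholomorphic symbol, that is, a symbol $\overline{\psi}$ with $\psi\in H^2$. Theorem.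 Let $\Phi,\Psi\in L^2$ be such that $A_\Phi,A_\Psi\in\mathcal T_u$. Then the product $A_\Phi A_\Psi$ of the bounded operators belongs to $\mathcal T_u$ if and only if one of the following two (not mutually exclusive) cases holds: (i) $A_\Phi$ or $A_\Psi$ is equal to $cI$ for some $c\in\mathbb C$; (ii) $A_\Phi$ and $A_\Psi$ are both of type $\alpha$ for some $\alpha$ in the Riemann sphere $\mathbb C\cup\{\infty\}$. Moreover, whenever $A_\Phi$ and $A_\Psi$ are both of type $\alpha$, for $\alpha\in\mathbb C\cup\{\infty\}$, the product $A_\Phi A_\Psi$ is of type $\alpha$ as well. -/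

import Mathlib

open MeasureTheory AddCircle
open scoped ENNReal

noncomputable section

namespace TTO

/-- The unit circle, parametrised as `ℝ / ℤ` through `t ↦ exp (2 π i t)`. -/
abbrev Torus : Type := AddCircle (1 : ℝ)

/-- Normalized Lebesgue (Haar probability) measure on the unit circle. -/
abbrev m : Measure Torus := haarAddCircle

/-- The Hilbert space `L²` of the circle. -/
abbrev L2 : Type := Lp ℂ 2 m

/-- The Hardy space `H²`: all `f ∈ L²` whose Fourier coefficients of negative index vanish. -/
def H2 : Submodule ℂ L2 where
  carrier := {f | ∀ n : ℤ, n < 0 → fourierCoeff (f : Torus → ℂ) n = 0}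
  zero_mem' := by
    intro n _
    rw [← fourierBasis_repr]
    simp
  add_mem' := by
    intro f g hf hg n hn
    have h1 := hf n hn
    have h2 := hg n hn
    rw [← fourierBasis_repr] at h1 h2 ⊢
    simp [h1, h2]
  smul_mem' := by
    intro c f hf n hn
    have h1 := hf n hn
    rw [← fourierBasis_repr] at h1 ⊢
    simp [h1]

theorem isClosed_H2 : IsClosed (H2 : Set L2) := by
  have h : (H2 : Set L2) =
      ⋂ n : ℤ, ⋂ _ : n < 0, {f : L2 | (inner ℂ (fourierBasis (T := 1) n) f : ℂ) = 0} := by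
    ext f
    simp only [Set.mem_iInter, Set.mem_ofPred_eq]
    constructor
    · intro hf n hn
      rw [← HilbertBasis.repr_apply_apply, fourierBasis_repr]
      exact hf n hn
    · intro hf n hn
      rw [← fourierBasis_repr, HilbertBasis.repr_apply_apply]
      exact hf n hn
  rw [h]
  refine isClosed_iInter fun n => isClosed_iInter fun _ => ?_
  exact isClosed_eq (by fun_prop) continuous_const

/-- The product `b f ∈ L²` of an essentially bounded function `b` and `f ∈ L²`. -/
def mulBdd (b : L2) (hb : MemLp b ∞ m) (f : L2) : L2 :=
  ((Lp.memLp f).mul hb : MemLp ((b : Torus → ℂ) * (f : Torus → ℂ)) 2 m).toLp _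

/-- Inner functions, given by their boundary values: `u ∈ H²` with `|u| = 1` almost everywhere. -/
structure InnerFunction where
  /-- the boundary function -/
  toL2 : L2
  mem_H2 : toL2 ∈ H2
  unimodular : ∀ᵐ t ∂m, ‖toL2 t‖ = 1

theorem InnerFunction.bdd (u : InnerFunction) : MemLp u.toL2 ∞ m :=
  memLp_top_of_bound (Lp.aestronglyMeasurable u.toL2) 1 (u.unimodular.mono fun _ h => h.le)

/-- `u` is constant (almost everywhere). -/
def InnerFunction.IsConstant (u : InnerFunction) : Prop :=
  ∃ c : ℂ, u.toL2 = Lp.const 2 m c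

/-- The coordinate function `z` on the circle. -/
def z : L2 := fourierLp 2 1

theorem z_bdd : MemLp z ∞ m := by
  refine memLp_top_of_bound (Lp.aestronglyMeasurable z) 1 ?_
  filter_upwards [coeFn_fourierLp (T := 1) 2 1] with t ht
  rw [z, ht]
  rw [fourier_apply, one_smul]
  exact (Circle.norm_coe _).le

/-- The subspace `u H²` of `L²`. -/
def uH2 (u : InnerFunction) : Submodule ℂ L2 where
  carrier := {g | ∃ h ∈ H2, g = mulBdd u.toL2 u.bdd h}
  zero_mem' := by
    refine ⟨0, H2.zero_mem, ?_⟩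
    apply Lp.ext
    filter_upwards [MemLp.coeFn_toLp ((Lp.memLp (0 : L2)).mul u.bdd (r := 2)),
      Lp.coeFn_zero ℂ 2 m] with t h1 h2
    rw [mulBdd, h1, h2]
    simp
  add_mem' := by
    rintro _ _ ⟨h, hh, rfl⟩ ⟨k, hk, rfl⟩
    refine ⟨h + k, H2.add_mem hh hk, ?_⟩
    rw [mulBdd, mulBdd, ← MemLp.toLp_add, mulBdd, MemLp.toLp_eq_toLp_iff]
    filter_upwards [Lp.coeFn_add h k] with t ht
    rw [Pi.add_apply, Pi.mul_apply, Pi.mul_apply, Pi.mul_apply]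
    rw [show (h + k : L2) t = h t + k t from ht, mul_add]
  smul_mem' := by
    rintro c _ ⟨h, hh, rfl⟩
    refine ⟨c • h, H2.smul_mem c hh, ?_⟩
    rw [mulBdd, ← MemLp.toLp_const_smul, mulBdd, MemLp.toLp_eq_toLp_iff]
    filter_upwards [Lp.coeFn_smul c h] with t ht
    simp [ht, mul_left_comm]

/-- The model space `K_u = H² ⊖ u H²`. -/
def K (u : InnerFunction) : Submodule ℂ L2 := H2 ⊓ (uH2 u)ᗮ

instance instCompleteSpaceK (u : InnerFunction) : CompleteSpace (K u) :=
  (isClosed_H2.inter (Submodule.isClosed_orthogonal (uH2 u))).completeSpace_coe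

/-- The orthogonal projection `P_u` of `L²` onto the model space. -/
def P (u : InnerFunction) : L2 →L[ℂ] K u := (K u).orthogonalProjectionOnto

/-- The truncated Toeplitz operator `A_Φ f = P_u (Φ f)` with symbol `Φ ∈ L²`, defined on the
bounded functions `f` of the model space. -/
def truncatedToeplitz (u : InnerFunction) (Φ : L2) (f : K u) (hf : MemLp (f : L2) ∞ m) : K u :=
  P u (mulBdd (f : L2) hf Φ)

/-- `Φ` is a symbol of the bounded operator `A` on the model space: `A` is the bounded extension
of `A_Φ` to the whole model space. -/
def HasSymbol (u : InnerFunction) (A : K u →L[ℂ] K u) (Φ : L2) : Prop :=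
  ∀ (f : K u) (hf : MemLp (f : L2) ∞ m), A f = truncatedToeplitz u Φ f hf

/-- `A` is a bounded truncated Toeplitz operator on the model space. -/
def IsTTO (u : InnerFunction) (A : K u →L[ℂ] K u) : Prop :=
  ∃ Φ : L2, HasSymbol u A Φ

/-- The conjugation `C f = u · conj (z f)`. -/
def C (u : InnerFunction) (f : L2) : L2 :=
  mulBdd u.toL2 u.bdd (star (mulBdd z z_bdd f))

/-- The compressed shift `S_u f = P_u (z f)`. It is written for all `f ∈ L²` and used only on the
model space, which the conjugation `C` maps to itself. -/
def S (u : InnerFunction) (f : L2) : K u := P u (mulBdd z z_bdd f)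

/-- The bounded operator `A` is a truncated Toeplitz operator of type `α`, for `α` in the Riemann
sphere. For finite `α` it has a symbol `φ + α · conj (S_u C φ) + c` with `φ ∈ K_u` and a
constant `c`; for `α = ∞` it has an antiholomorphic symbol, the conjugate of a function of `H²`. -/
def IsOfType (u : InnerFunction) (A : K u →L[ℂ] K u) : OnePoint ℂ → Prop
  | none => ∃ ψ ∈ H2, HasSymbol u A (star ψ)
  | some α => ∃ (φ : K u) (c : ℂ),
      HasSymbol u A ((φ : L2) + α • star (S u (C u (φ : L2)) : L2) + Lp.const 2 m c)

end TTO

end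

open scoped InnerProductSpace InnerProduct ComplexConjugate
open Filter Topology

namespace TTO

/-! Write (x ⊗ y)v = ⟨y, v⟩x, S = S_u, and k = P_u 1, the reproducing kernel at 0. Sarason's
criterion (`HasSymbol.rep`, `hasSymbol_of_rep`) says that a bounded A is a TTO exactly when A - S A
S* = φ ⊗ k + k ⊗ χ, and then φ + conj χ is a symbol. TTOs are moreover C-symmetric: A C = C A*.

These two facts reduce the theorem to algebra with S, C and k. For A, B with pairs (φ₁, χ₁), (φ₂,
χ₂), `Rep.comp` shows that AB - S A B S* equals φ₁ ⊗ χ₂ - SCχ₁ ⊗ SCφ₂ up to terms ψ ⊗ k + k ⊗ ξ. If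
AB is a TTO, the two rank-one operators therefore agree modulo k on the orthogonal complement of k.
Either both vanish there, which gives a scalar factor or the common type 0 or ∞, or their factors
are proportional modulo k, which gives a common finite nonzero type (`Rep.types_of_comp`).

Conversely, a common type makes the difference of tensors collapse to a term k ⊗ ξ, so AB is a TTO.
For finite type, AB is then C-symmetric, so A and B commute after subtraction of scalars; comparing
the defects of AB and BA shows that AB has the same type (`FiniteType.comp`). -/

/-- A contraction `S` with one-dimensional defect, intertwined with its adjoint by a
conjugation `C`, whose defect vector `k` satisfies `S C k = -a k`. -/
structure ConjugatedShift (H : Type*) [NormedAddCommGroup H] [InnerProductSpace ℂ H]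
    [CompleteSpace H] where
  /-- the contraction -/
  S : H →L[ℂ] H
  /-- the conjugation -/
  C : H →ₗ⋆[ℂ] H
  /-- the defect vector -/
  k : H
  /-- the scalar with `S C k = -a k` -/
  a : ℂ
  C_C : ∀ x, C (C x) = x
  inner_C_C : ∀ x y, ⟪C x, C y⟫_ℂ = ⟪y, x⟫_ℂ
  S_C : ∀ x, S (C x) = C ((S†) x)
  S_adjoint : ∀ x, S ((S†) x) = x - ⟪k, x⟫_ℂ • k
  S_C_k : S (C k) = -(a • k)
  k_ne : k ≠ 0

namespace ConjugatedShift

variable {H : Type*} [NormedAddCommGroup H] [InnerProductSpace ℂ H] [CompleteSpace H]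
  (M : ConjugatedShift H)

/-! ### Identities between shift, conjugation and defect vector -/

theorem inner_C_left (x y : H) : ⟪M.C x, y⟫_ℂ = ⟪M.C y, x⟫_ℂ := by
  rw [← M.inner_C_C y (M.C x), M.C_C]

theorem inner_C_right (x y : H) : ⟪x, M.C y⟫_ℂ = ⟪y, M.C x⟫_ℂ := by
  rw [← inner_conj_symm, M.inner_C_left, inner_conj_symm]

theorem adjoint_C (x : H) : (M.S†) (M.C x) = M.C (M.S x) := by
  rw [← M.C_C ((M.S†) (M.C x)), ← M.S_C, M.C_C]

theorem adjoint_S (x : H) : (M.S†) (M.S x) = x - ⟪M.C M.k, x⟫_ℂ • M.C M.k := by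
  have h := M.S_adjoint (M.C x)
  rw [M.adjoint_C, M.S_C] at h
  rw [← M.C_C ((M.S†) (M.S x)), h, map_sub, M.C_C, map_smulₛₗ, inner_conj_symm,
    M.inner_C_left]

theorem adjoint_k : (M.S†) M.k = -(conj M.a • M.C M.k) := by
  rw [← M.C_C M.k, M.adjoint_C, M.S_C_k, map_neg, map_smulₛₗ, M.C_C]

theorem inner_k_ne : ⟪M.k, M.k⟫_ℂ ≠ 0 := inner_self_ne_zero.2 M.k_ne

/-- Compute S S* k twice: from the defect formula, and from S* k = -conj a • C k followed by S C k =
-a k. -/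
theorem inner_k_k : ⟪M.k, M.k⟫_ℂ = 1 - M.a * conj M.a := by
  have h := M.S_adjoint M.k
  rw [M.adjoint_k, map_neg, map_smul, M.S_C_k, smul_neg, neg_neg, smul_smul] at h
  have h2 : (1 - M.a * conj M.a - ⟪M.k, M.k⟫_ℂ) • M.k = 0 := by
    rw [sub_smul, sub_smul, one_smul, mul_comm, h]; module
  rcases smul_eq_zero.1 h2 with h3 | h3
  · linear_combination -h3
  · exact absurd h3 M.k_ne

/-! ### The displacement equation and its calculus -/

/-- `A - S A S* = φ ⊗ k + k ⊗ χ`. -/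
def Rep (A : H →L[ℂ] H) (φ χ : H) : Prop :=
  ∀ x, A x - M.S (A ((M.S†) x)) = ⟪M.k, x⟫_ℂ • φ + ⟪χ, x⟫_ℂ • M.k

/-- `A C = C A*`. -/
def CSymm (A : H →L[ℂ] H) : Prop := ∀ x, A (M.C x) = M.C ((A†) x)

variable {M} {A B : H →L[ℂ] H} {φ χ φ₁ χ₁ φ₂ χ₂ : H}

theorem Rep.add (hA : M.Rep A φ₁ χ₁) (hB : M.Rep B φ₂ χ₂) :
    M.Rep (A + B) (φ₁ + φ₂) (χ₁ + χ₂) := by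
  intro x
  have h1 := hA x
  have h2 := hB x
  simp only [add_apply, map_add, inner_add_left]
  linear_combination (norm := module) h1 + h2

theorem Rep.smul (hA : M.Rep A φ χ) (c : ℂ) : M.Rep (c • A) (c • φ) (conj c • χ) := by
  intro x
  have h1 := hA x
  simp only [smul_apply, map_smul, inner_smul_left, Complex.conj_conj,
    ← smul_sub, h1]
  module

theorem Rep.sub_id (hA : M.Rep A φ χ) (c : ℂ) :
    M.Rep (A - c • ContinuousLinearMap.id ℂ H) φ (χ - conj c • M.k) := by
  intro x
  have h1 := hA x
  have h2 := M.S_adjoint x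
  simp only [sub_apply, smul_apply, map_sub,
    ContinuousLinearMap.id_apply, map_smul, inner_sub_left, inner_smul_left, Complex.conj_conj, h2]
  linear_combination (norm := module) h1

/-- A multiple of k ⊗ k can be moved between the two summands; by `Rep.unique` this is the only
freedom in φ. -/
theorem Rep.gauge (hA : M.Rep A φ χ) (c : ℂ) : M.Rep A (φ - c • M.k) (χ + conj c • M.k) := by
  intro x
  rw [hA x]
  simp only [inner_add_left, inner_smul_left, Complex.conj_conj]
  module

theorem Rep.adjoint (hA : M.Rep A φ χ) : M.Rep (A†) χ φ := by
  intro x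
  refine ext_inner_right ℂ fun y => ?_
  have h := congrArg (fun v => ⟪x, v⟫_ℂ) (hA y)
  simp only [inner_sub_right, inner_add_right, inner_smul_right] at h
  simp only [inner_sub_left, inner_add_left, inner_smul_left, inner_conj_symm,
    ContinuousLinearMap.adjoint_inner_left]
  rw [← ContinuousLinearMap.adjoint_inner_right M.S, ContinuousLinearMap.adjoint_inner_left,
    ContinuousLinearMap.adjoint_inner_left, h]
  ring

theorem CSymm.adjoint (hA : M.CSymm A) : M.CSymm (A†) := by
  intro x
  rw [ContinuousLinearMap.adjoint_adjoint, ← M.C_C ((A†) (M.C x)), ← hA, M.C_C]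

theorem Rep.unique {φ' χ' : H} (h : M.Rep A φ χ) (h' : M.Rep A φ' χ') :
    ∃ c : ℂ, φ' = φ + c • M.k := by
  have h1 := (h M.k).symm.trans (h' M.k)
  refine ⟨(⟪M.k, M.k⟫_ℂ)⁻¹ * (⟪χ, M.k⟫_ℂ - ⟪χ', M.k⟫_ℂ), ?_⟩
  have h2 : ⟪M.k, M.k⟫_ℂ • φ' = ⟪M.k, M.k⟫_ℂ • φ + (⟪χ, M.k⟫_ℂ - ⟪χ', M.k⟫_ℂ) • M.k := by
    linear_combination (norm := module) -h1
  rw [← smul_right_injective H M.inner_k_ne |>.eq_iff]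
  simp only [smul_add, smul_smul, mul_inv_cancel_left₀ M.inner_k_ne]
  exact h2

/-- The companion identity `A - S* A S = Cχ ⊗ Ck + Ck ⊗ Cφ`. -/
theorem Rep.conjugate (hA : M.Rep A φ χ) (hC : M.CSymm A) (x : H) :
    A x - (M.S†) (A (M.S x)) = ⟪M.C M.k, x⟫_ℂ • M.C χ + ⟪M.C φ, x⟫_ℂ • M.C M.k := by
  have h := congrArg M.C (hA.adjoint (M.C x))
  simp only [map_sub, map_add, map_smulₛₗ, inner_conj_symm] at h
  have h2 : M.C ((A†) (M.C (M.S x))) = A (M.S x) := by rw [← hC, M.C_C]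
  rw [← hC, M.C_C, M.adjoint_C, ← M.adjoint_C, h2] at h
  rw [h, M.inner_C_left x, M.inner_C_left x]

theorem inner_k_S_C (x : H) : ⟪M.k, M.S (M.C x)⟫_ℂ = - (M.a * ⟪x, M.k⟫_ℂ) := by
  rw [← ContinuousLinearMap.adjoint_inner_left, M.adjoint_k, inner_neg_left, inner_smul_left,
    M.inner_C_C, Complex.conj_conj]

/-- The two values of a represented `C`-symmetric operator at the defect vectors. -/
theorem Rep.apply_defect (hA : M.Rep A φ χ) (hC : M.CSymm A) :
    A M.k = φ - conj M.a • M.S (M.C χ) + ⟪χ, M.k⟫_ℂ • M.k ∧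
      M.S (A (M.C M.k)) = M.S (M.C χ) - M.a • φ := by
  -- With S C k = -a k and S* k = -conj a • C k, the companion identity at C k and the displacement
  -- equation at k become a linear system for A k and S A C k.
  have e1 := congrArg M.S (hA.conjugate hC (M.C M.k))
  have e2 := hA M.k
  rw [M.S_C_k, M.inner_C_C, M.inner_C_C] at e1
  rw [M.adjoint_k] at e2
  simp only [map_sub, map_add, map_neg, map_smul, M.S_C_k, M.S_adjoint, M.inner_k_k] at e1 e2
  have s1 := congrArg (fun v => ⟪M.k, v⟫_ℂ) e1
  have s2 := congrArg (fun v => ⟪M.k, v⟫_ℂ) e2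
  simp only [inner_sub_right, inner_add_right, inner_neg_right, inner_smul_right,
    M.inner_k_S_C, M.inner_k_k] at s1 s2
  have hκ : 1 - M.a * conj M.a ≠ 0 := M.inner_k_k ▸ M.inner_k_ne
  -- The unknown scalar ⟨k, A k⟩ must be found first: pairing the system with k leaves it with
  -- coefficient 1 - |a|⁴ = (1 + |a|²)(1 - |a|²).
  have hp : 1 + M.a * conj M.a ≠ 0 := by
    rw [Complex.mul_conj]
    exact_mod_cast (by linarith [Complex.normSq_nonneg M.a] : (0 : ℝ) < 1 + Complex.normSq M.a).ne'
  have ht : ⟪M.k, A M.k⟫_ℂ = ⟪M.k, φ⟫_ℂ + ⟪χ, M.k⟫_ℂ := by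
    refine mul_left_cancel₀ (mul_ne_zero hp hκ) ?_
    linear_combination s2 - conj M.a * s1
  rw [ht] at e1
  have h1 : A M.k = φ - conj M.a • M.S (M.C χ) + ⟪χ, M.k⟫_ℂ • M.k := by
    refine smul_right_injective H hκ ?_
    linear_combination (norm := module) e2 - conj M.a • e1
  refine ⟨h1, ?_⟩
  rw [h1] at e1
  linear_combination (norm := module) e1

/-- The defect of a product of two represented `C`-symmetric operators. -/
theorem Rep.comp (hA : M.Rep A φ₁ χ₁) (hB : M.Rep B φ₂ χ₂) (hCA : M.CSymm A) (hCB : M.CSymm B)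
    (x : H) : A (B x) - M.S (A (B ((M.S†) x))) =
      ⟪M.k, x⟫_ℂ • A φ₂ + ⟪(B†) χ₁ - ⟪φ₂, χ₁⟫_ℂ • M.k, x⟫_ℂ • M.k
        + ⟪χ₂, x⟫_ℂ • φ₁ - ⟪M.S (M.C φ₂), x⟫_ℂ • M.S (M.C χ₁) := by
  -- S A S* S B S* x appears here. Since S* S = I - Ck ⊗ Ck, it differs from S A B S* x by ⟨C k, B
  -- S* x⟩ S A C k, and both factors come from `Rep.apply_defect`, applied to B* and A.
  have h1 := hA (M.S (B ((M.S†) x)))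
  rw [M.adjoint_S] at h1
  have h2 := hB x
  have h3 : M.S (B ((M.S†) x)) = B x - ⟪M.k, x⟫_ℂ • φ₂ - ⟪χ₂, x⟫_ℂ • M.k := by
    rw [sub_sub, ← h2]; abel
  have h4 : ⟪M.C M.k, B ((M.S†) x)⟫_ℂ = ⟪M.S (M.C φ₂) - M.a • χ₂, x⟫_ℂ := by
    rw [← (hB.adjoint.apply_defect hCB.adjoint).2, ← ContinuousLinearMap.adjoint_inner_right,
      ContinuousLinearMap.adjoint_inner_left]
  have h5 : ⟪M.k, B x⟫_ℂ = ⟪χ₂ - conj M.a • M.S (M.C φ₂) + ⟪φ₂, M.k⟫_ℂ • M.k, x⟫_ℂ := by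
    rw [← (hB.adjoint.apply_defect hCB.adjoint).1, ContinuousLinearMap.adjoint_inner_left]
  simp only [map_sub, map_smul, h4, (hA.apply_defect hCA).2] at h1
  rw [h3] at h1
  simp only [map_sub, map_smul, inner_sub_right, inner_smul_right, h5,
    (hA.apply_defect hCA).1, M.inner_k_k] at h1
  simp only [inner_sub_left, inner_add_left, inner_smul_left, Complex.conj_conj, inner_conj_symm,
    ContinuousLinearMap.adjoint_inner_left] at h1 ⊢
  linear_combination (norm := module) h1

/-! ### Working modulo the defect vector: the types -/

variable (M) in
/-- The line spanned by the defect vector. -/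
def defectLine : Submodule ℂ H := Submodule.span ℂ {M.k}

theorem mem_defectLine {x : H} : x ∈ M.defectLine ↔ ∃ c : ℂ, c • M.k = x :=
  Submodule.mem_span_singleton

theorem smul_k_mem (c : ℂ) : c • M.k ∈ M.defectLine := mem_defectLine.2 ⟨c, rfl⟩

/-- Modulo k the map S C is a conjugate-linear involution; hence it both preserves and reflects
membership in the defect line. -/
theorem S_C_S_C (x : H) : M.S (M.C (M.S (M.C x))) = x - ⟪M.k, x⟫_ℂ • M.k := by
  rw [M.S_C x, M.C_C, M.S_adjoint]

theorem S_C_mem {x : H} (hx : x ∈ M.defectLine) : M.S (M.C x) ∈ M.defectLine := by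
  obtain ⟨c, rfl⟩ := mem_defectLine.1 hx
  rw [map_smulₛₗ, map_smul, M.S_C_k, smul_neg, smul_smul]
  exact neg_mem (smul_k_mem _)

theorem S_C_mem_iff {x : H} : M.S (M.C x) ∈ M.defectLine ↔ x ∈ M.defectLine := by
  refine ⟨fun h => ?_, S_C_mem⟩
  have h1 := S_C_mem h
  rw [S_C_S_C] at h1
  simpa using add_mem h1 (smul_k_mem ⟪M.k, x⟫_ℂ)

theorem mem_defectLine_of_inner_eq_zero {x : H}
    (h : ∀ v, ⟪M.k, v⟫_ℂ = 0 → ⟪x, v⟫_ℂ = 0) : x ∈ M.defectLine := by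
  set c := (⟪M.k, M.k⟫_ℂ)⁻¹ * ⟪M.k, x⟫_ℂ
  have h1 : ⟪M.k, x - c • M.k⟫_ℂ = 0 := by
    rw [inner_sub_right, inner_smul_right, mul_comm c, mul_inv_cancel_left₀ M.inner_k_ne, sub_self]
  have h2 : ⟪x - c • M.k, x - c • M.k⟫_ℂ = 0 := by
    rw [inner_sub_left, inner_smul_left, h1, h _ h1]; simp
  exact mem_defectLine.2 ⟨c, (sub_eq_zero.1 (inner_self_eq_zero.1 h2)).symm⟩

variable (M) in
/-- Up to a multiple of the identity, `A` is represented by `φ` and `conj α • S C φ`. -/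
def FiniteType (A : H →L[ℂ] H) (α : ℂ) : Prop :=
  ∃ (φ : H) (c : ℂ),
    M.Rep (A - c • ContinuousLinearMap.id ℂ H) φ (conj α • M.S (M.C φ))

variable (M) in
/-- `A` is represented by `0` and some `χ`. -/
def InfiniteType (A : H →L[ℂ] H) : Prop := ∃ χ : H, M.Rep A 0 χ

theorem Rep.finiteType {α : ℂ} (hA : M.Rep A φ χ)
    (h : χ - conj α • M.S (M.C φ) ∈ M.defectLine) : M.FiniteType A α := by
  obtain ⟨c, hc⟩ := mem_defectLine.1 h
  refine ⟨φ, conj c, ?_⟩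
  have := hA.sub_id (conj c)
  rwa [Complex.conj_conj, hc, sub_sub_cancel] at this

theorem Rep.infiniteType (hA : M.Rep A φ χ) (h : φ ∈ M.defectLine) : M.InfiniteType A := by
  obtain ⟨c, rfl⟩ := mem_defectLine.1 h
  have := hA.gauge c
  rw [sub_self] at this
  exact ⟨_, this⟩

theorem Rep.scalar (hA : M.Rep A φ χ) (h : φ ∈ M.defectLine) (h' : χ ∈ M.defectLine) :
    ∃ c : ℂ, M.Rep (A - c • ContinuousLinearMap.id ℂ H) 0 0 := by
  obtain ⟨c, rfl⟩ := mem_defectLine.1 h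
  have h1 := hA.gauge c
  obtain ⟨d, hd⟩ := mem_defectLine.1 (add_mem h' (smul_k_mem (conj c)))
  refine ⟨conj d, ?_⟩
  have h2 := h1.sub_id (conj d)
  rwa [sub_self, Complex.conj_conj, ← hd, sub_self] at h2

/-- If a product of represented `C`-symmetric operators is represented, then one factor is scalar
or both have the same type. -/
theorem Rep.types_of_comp {ψ ξ : H} (hA : M.Rep A φ₁ χ₁) (hB : M.Rep B φ₂ χ₂)
    (hCA : M.CSymm A) (hCB : M.CSymm B) (h : M.Rep (A ∘L B) ψ ξ) :
    ((∃ c : ℂ, M.Rep (A - c • ContinuousLinearMap.id ℂ H) 0 0) ∨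
      (∃ c : ℂ, M.Rep (B - c • ContinuousLinearMap.id ℂ H) 0 0)) ∨
    (M.InfiniteType A ∧ M.InfiniteType B) ∨
    ∃ α : ℂ, M.FiniteType A α ∧ M.FiniteType B α := by
  -- On vectors orthogonal to k, every term ψ ⊗ k vanishes and every term k ⊗ ξ lands in the defect
  -- line; only the two tensors remain.
  have key : ∀ v, ⟪M.k, v⟫_ℂ = 0 →
      ⟪χ₂, v⟫_ℂ • φ₁ - ⟪M.S (M.C φ₂), v⟫_ℂ • M.S (M.C χ₁) ∈ M.defectLine := by
    intro v hv
    have h1 := (hA.comp hB hCA hCB v).symm.trans (h v)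
    rw [hv] at h1
    refine mem_defectLine.2
      ⟨⟪ξ, v⟫_ℂ - ⟪(B†) χ₁ - ⟪φ₂, χ₁⟫_ℂ • M.k, v⟫_ℂ, ?_⟩
    linear_combination (norm := module) -h1
  -- A rank-one operator that vanishes modulo k has a trivial factor, and S C can be stripped from
  -- that factor.
  have aux : (∀ v, ⟪M.k, v⟫_ℂ = 0 → ⟪M.S (M.C φ₂), v⟫_ℂ • M.S (M.C χ₁) ∈ M.defectLine) →
      χ₁ ∈ M.defectLine ∨ φ₂ ∈ M.defectLine := by
    intro hv
    by_contra! hcon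
    refine hcon.2 (S_C_mem_iff.1 (mem_defectLine_of_inner_eq_zero fun v hkv => ?_))
    by_contra hne
    exact hcon.1 (S_C_mem_iff.1 ((Submodule.smul_mem_iff _ hne).1 (hv v hkv)))
  have type_zero : ∀ {A : H →L[ℂ] H} {φ χ : H}, M.Rep A φ χ → χ ∈ M.defectLine →
      M.FiniteType A 0 := fun hA h => hA.finiteType (by simpa using h)
  by_cases hφ₁ : φ₁ ∈ M.defectLine
  · rcases aux fun v hv => by
      simpa using sub_mem (M.defectLine.smul_mem ⟪χ₂, v⟫_ℂ hφ₁) (key v hv) with h1 | h1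
    · exact Or.inl (Or.inl (hA.scalar hφ₁ h1))
    · exact Or.inr (Or.inl ⟨hA.infiniteType hφ₁, hB.infiniteType h1⟩)
  by_cases hχ₂ : χ₂ ∈ M.defectLine
  · rcases aux fun v hv => by
      have : ⟪χ₂, v⟫_ℂ = 0 := by
        obtain ⟨c, rfl⟩ := mem_defectLine.1 hχ₂
        rw [inner_smul_left, hv, mul_zero]
      simpa [this] using key v hv with h1 | h1
    · exact Or.inr (Or.inr ⟨0, type_zero hA h1, type_zero hB hχ₂⟩)
    · exact Or.inl (Or.inr (hB.scalar h1 hχ₂))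
  -- Generic case, with φ₁ ⊗ χ₂ nonzero modulo k: evaluation at v gives φ₁ ≡ l SCχ₁, and then SCφ₂ ≡
  -- conj l • χ₂. Applying S C to the first relation yields SCφ₁ ≡ conj l • χ₁, so the common type
  -- is l⁻¹.
  obtain ⟨v, hv, hne⟩ : ∃ v, ⟪M.k, v⟫_ℂ = 0 ∧ ⟪χ₂, v⟫_ℂ ≠ 0 := by
    by_contra! hcon
    exact hχ₂ (mem_defectLine_of_inner_eq_zero hcon)
  obtain ⟨c, hc⟩ := mem_defectLine.1 (key v hv)
  obtain ⟨l, e, hl⟩ : ∃ l e : ℂ, φ₁ = l • M.S (M.C χ₁) + e • M.k := by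
    refine ⟨(⟪χ₂, v⟫_ℂ)⁻¹ * ⟪M.S (M.C φ₂), v⟫_ℂ, (⟪χ₂, v⟫_ℂ)⁻¹ * c, ?_⟩
    refine smul_right_injective H hne ?_
    simp only [smul_add, smul_smul, mul_inv_cancel_left₀ hne, hc]
    module
  have hl0 : l ≠ 0 := by
    rintro rfl
    exact hφ₁ (by rw [hl]; simpa using smul_k_mem e)
  have hWχ₁ : M.S (M.C χ₁) ∉ M.defectLine := fun hmem =>
    hφ₁ (by rw [hl]; exact add_mem (Submodule.smul_mem _ _ hmem) (smul_k_mem e))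
  have h2 : M.S (M.C φ₂) - conj l • χ₂ ∈ M.defectLine := by
    refine mem_defectLine_of_inner_eq_zero fun w hw => ?_
    by_contra hne'
    refine hWχ₁ ((Submodule.smul_mem_iff _ hne').1 ?_)
    have := sub_mem (M.defectLine.smul_mem ⟪χ₂, w⟫_ℂ (smul_k_mem e)) (key w hw)
    rw [hl] at this
    convert this using 1
    rw [inner_sub_left, inner_smul_left, Complex.conj_conj]
    module
  have h1 : M.S (M.C φ₁) - conj l • χ₁ ∈ M.defectLine := by
    rw [hl, map_add, map_add, map_smulₛₗ, map_smul, S_C_S_C]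
    have := sub_mem (S_C_mem (smul_k_mem (M := M) e))
      (M.defectLine.smul_mem (conj l) (smul_k_mem ⟪M.k, χ₁⟫_ℂ))
    convert this using 1
    module
  have fin : ∀ {φ χ : H}, M.S (M.C φ) - conj l • χ ∈ M.defectLine →
      χ - conj l⁻¹ • M.S (M.C φ) ∈ M.defectLine := by
    intro φ χ h
    have hl' : conj l ≠ 0 := by simpa using hl0
    have := M.defectLine.smul_mem (-(conj l)⁻¹) h
    rwa [smul_sub, smul_smul, neg_mul, inv_mul_cancel₀ hl', neg_smul, neg_smul, one_smul,
      sub_neg_eq_add, neg_add_eq_sub, ← map_inv₀] at this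
  exact Or.inr (Or.inr ⟨l⁻¹, hA.finiteType (fin h1), hB.finiteType (fin h2)⟩)

/-! ### Products of operators of the same type -/

/-- A B C = C A* B* by symmetry of the factors, and A B C = C B* A* by symmetry of the product. -/
theorem CSymm.comm_of_comp (hA : M.CSymm A) (hB : M.CSymm B) (hAB : M.CSymm (A ∘L B)) :
    A ∘L B = B ∘L A := by
  have h : ∀ x, (A†) ((B†) x) = (B†) ((A†) x) := by
    intro x
    have h1 := hAB x
    rw [ContinuousLinearMap.comp_apply, hB, hA, ContinuousLinearMap.adjoint_comp,
      ContinuousLinearMap.comp_apply] at h1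
    rw [← M.C_C ((A†) ((B†) x)), h1, M.C_C]
  ext x
  rw [← M.C_C x]
  simp only [ContinuousLinearMap.comp_apply, hA _, hB _, h]

/-- Here SCχ₁ = α(φ₁ - ⟨k, φ₁⟩k), so SCχ₁ ⊗ SCφ₂ cancels φ₁ ⊗ χ₂ except for a term k ⊗ SCφ₂. -/
theorem Rep.comp_of_type {α : ℂ} (hCA : M.CSymm A) (hCB : M.CSymm B)
    (hA : M.Rep A φ₁ (conj α • M.S (M.C φ₁))) (hB : M.Rep B φ₂ (conj α • M.S (M.C φ₂))) :
    M.Rep (A ∘L B) (A φ₂) ((B†) (conj α • M.S (M.C φ₁))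
      - ⟪φ₂, conj α • M.S (M.C φ₁)⟫_ℂ • M.k + (conj α * ⟪φ₁, M.k⟫_ℂ) • M.S (M.C φ₂)) := by
  intro x
  refine (hA.comp hB hCA hCB x).trans ?_
  rw [inner_add_left, map_smulₛₗ M.C, map_smul M.S, S_C_S_C]
  simp only [inner_smul_left, map_mul, inner_conj_symm, Complex.conj_conj]
  module

/-- The hypothesis `hT` is where the model space enters: there a represented operator has a symbol,
and symbols give C-symmetry. -/
theorem FiniteType.comp {α : ℂ} (hT : ∀ (T : H →L[ℂ] H) (ψ ξ : H), M.Rep T ψ ξ → M.CSymm T)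
    (hA : M.FiniteType A α) (hB : M.FiniteType B α) : M.FiniteType (A ∘L B) α := by
  obtain ⟨φ₁, c, hA⟩ := hA
  obtain ⟨φ₂, d, hB⟩ := hB
  generalize hA' : A - c • ContinuousLinearMap.id ℂ H = A' at hA
  generalize hB' : B - d • ContinuousLinearMap.id ℂ H = B' at hB
  have hCA := hT _ _ _ hA
  have hCB := hT _ _ _ hB
  have hAB := hA.comp_of_type hCA hCB hB
  have hBA := hB.comp_of_type hCB hCA hA
  rw [← hCA.comm_of_comp hCB (hT _ _ _ hAB)] at hBA
  -- As A'B' = B'A', uniqueness gives A'φ₂ ≡ B'φ₁ modulo k.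
  obtain ⟨e, he⟩ := hBA.unique hAB
  -- The displacement equation of B'* at SCφ₁, together with B'* C = C B', identifies the second
  -- vector of A'B' as conj α • SC(B'φ₁) modulo k.
  have hmem : (B'†) (M.S (M.C φ₁)) + ⟪φ₁, M.k⟫_ℂ • M.S (M.C φ₂) - M.S (M.C (B' φ₁))
      ∈ M.defectLine := by
    have h1 := hB.adjoint (M.S (M.C φ₁))
    have h2 := hCB.adjoint φ₁
    rw [ContinuousLinearMap.adjoint_adjoint] at h2
    rw [M.adjoint_S, map_sub, map_sub, map_smul, map_smul,
      (hB.adjoint.apply_defect hCB.adjoint).2, inner_k_S_C, M.inner_C_C, h2] at h1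
    refine mem_defectLine.2 ⟨⟪φ₂, M.S (M.C φ₁)⟫_ℂ, ?_⟩
    linear_combination (norm := module) -h1
  obtain ⟨s, hs⟩ := mem_defectLine.1 hmem
  obtain ⟨t, ht⟩ := mem_defectLine.1 (S_C_mem (smul_k_mem (M := M) e))
  obtain ⟨φ, r, hAB⟩ : M.FiniteType (A' ∘L B') α := by
    refine hAB.finiteType (mem_defectLine.2
      ⟨conj α * s - conj α * t - ⟪φ₂, conj α • M.S (M.C φ₁)⟫_ℂ, ?_⟩)
    rw [he, map_add, map_add, ← ht, map_smul (B'†)]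
    linear_combination (norm := module) conj α • hs
  -- Undo the normalization: AB - (r + cd) = (A'B' - r) + cB' + dA'.
  refine ⟨φ + c • φ₂ + d • φ₁, r + c * d, ?_⟩
  convert (hAB.add (hB.smul c)).add (hA.smul d) using 1
  · rw [← hA', ← hB']
    ext x
    simp only [ContinuousLinearMap.comp_apply, sub_apply, add_apply, smul_apply,
      ContinuousLinearMap.id_apply, map_sub, map_smul]
    module
  · simp only [map_add, map_smulₛₗ M.C, map_smul M.S]
    module

theorem InfiniteType.comp (hT : ∀ (T : H →L[ℂ] H) (ψ ξ : H), M.Rep T ψ ξ → M.CSymm T)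
    (hA : M.InfiniteType A) (hB : M.InfiniteType B) : M.InfiniteType (A ∘L B) := by
  obtain ⟨χ₁, hA⟩ := hA
  obtain ⟨χ₂, hB⟩ := hB
  refine ⟨(B†) χ₁, fun x => (hA.comp hB (hT _ _ _ hA) (hT _ _ _ hB) x).trans ?_⟩
  simp

/-! ### Verification on a dense set -/

variable (M) in
theorem continuous_C : Continuous M.C := by
  refine (AddMonoidHomClass.isometry_of_norm M.C fun x => ?_).continuous
  rw [@norm_eq_sqrt_re_inner ℂ, M.inner_C_C, ← norm_eq_sqrt_re_inner]

theorem rep_of_dense {D : Set H} (hD : Dense D)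
    (h : ∀ f ∈ D, ∀ g ∈ D, ⟪g, A f - M.S (A ((M.S†) f))⟫_ℂ =
      ⟪g, ⟪M.k, f⟫_ℂ • φ + ⟪χ, f⟫_ℂ • M.k⟫_ℂ) : M.Rep A φ χ :=
  congrFun (Continuous.ext_on hD (by fun_prop) (by fun_prop) fun f hf =>
    hD.eq_of_inner_right ℂ fun g hg => h f hf g hg)

theorem cSymm_of_dense {D : Set H} (hD : Dense D)
    (h : ∀ f ∈ D, ∀ g ∈ D, ⟪g, A (M.C f)⟫_ℂ = ⟪f, A (M.C g)⟫_ℂ) : M.CSymm A := by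
  refine congrFun (Continuous.ext_on hD (A.continuous.comp M.continuous_C)
    (M.continuous_C.comp (A†).continuous) fun f hf =>
      hD.eq_of_inner_right ℂ fun g hg => ?_)
  change ⟪g, A (M.C f)⟫_ℂ = ⟪g, M.C ((A†) f)⟫_ℂ
  rw [h f hf g hg, M.inner_C_right, ContinuousLinearMap.adjoint_inner_left]

end ConjugatedShift

/-! ### Multiplication by bounded functions -/

theorem coeFn_mulBdd (b : L2) (hb : MemLp b ∞ m) (f : L2) :
    ∀ᵐ t ∂m, mulBdd b hb f t = b t * f t :=
  MemLp.coeFn_toLp _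

theorem mulBdd_add (b : L2) (hb : MemLp b ∞ m) (f g : L2) :
    mulBdd b hb (f + g) = mulBdd b hb f + mulBdd b hb g := by
  apply Lp.ext
  filter_upwards [coeFn_mulBdd b hb (f + g), coeFn_mulBdd b hb f, coeFn_mulBdd b hb g,
    Lp.coeFn_add f g, Lp.coeFn_add (mulBdd b hb f) (mulBdd b hb g)] with t h1 h2 h3 h4 h5
  rw [h1, h4, h5, Pi.add_apply, Pi.add_apply, h2, h3, mul_add]

theorem mulBdd_smul (b : L2) (hb : MemLp b ∞ m) (c : ℂ) (f : L2) :
    mulBdd b hb (c • f) = c • mulBdd b hb f := by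
  apply Lp.ext
  filter_upwards [coeFn_mulBdd b hb (c • f), coeFn_mulBdd b hb f,
    Lp.coeFn_smul c f, Lp.coeFn_smul c (mulBdd b hb f)] with t h1 h2 h3 h4
  rw [h1, h3, h4, Pi.smul_apply, Pi.smul_apply, h2, smul_eq_mul, smul_eq_mul, mul_left_comm]

theorem mulBdd_sub (b : L2) (hb : MemLp b ∞ m) (f g : L2) :
    mulBdd b hb (f - g) = mulBdd b hb f - mulBdd b hb g := by
  rw [sub_eq_add_neg, ← neg_one_smul ℂ g, mulBdd_add, mulBdd_smul, neg_one_smul, ← sub_eq_add_neg]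

/-- Reduces an identity of inner products to a pointwise identity of integrands, in which |u| = |z|
= 1 can be used. -/
theorem inner_congr {f g f' g' : L2}
    (h : ∀ᵐ t ∂m, conj (f t) * g t = conj (f' t) * g' t) : ⟪f, g⟫_ℂ = ⟪f', g'⟫_ℂ := by
  rw [L2.inner_def, L2.inner_def]
  refine integral_congr_ae ?_
  filter_upwards [h] with t ht
  rw [RCLike.inner_apply', RCLike.inner_apply']
  exact ht

theorem bdd_star {b : L2} (hb : MemLp b ∞ m) : MemLp (star b : L2) ∞ m :=
  hb.star.ae_eq (Lp.coeFn_star b).symm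

theorem coeFn_star' (b : L2) : ∀ᵐ t ∂m, (star b : L2) t = conj (b t) := Lp.coeFn_star b

theorem inner_mulBdd_left (b : L2) (hb : MemLp b ∞ m) (f g : L2) :
    ⟪mulBdd b hb f, g⟫_ℂ = ⟪f, mulBdd (star b) (bdd_star hb) g⟫_ℂ := by
  refine inner_congr ?_
  filter_upwards [coeFn_mulBdd b hb f, coeFn_mulBdd (star b) (bdd_star hb) g, coeFn_star' b]
    with t h1 h2 h3
  rw [h1, h2, h3, map_mul]
  ring

theorem inner_star_star (f g : L2) : ⟪star f, star g⟫_ℂ = ⟪g, f⟫_ℂ := by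
  refine inner_congr ?_
  filter_upwards [coeFn_star' f, coeFn_star' g] with t h1 h2
  rw [h1, h2, Complex.conj_conj, mul_comm]

theorem inner_mulBdd_swap {f g : L2} (hf : MemLp f ∞ m) (hg : MemLp g ∞ m) (Φ : L2) :
    ⟪g, mulBdd f hf Φ⟫_ℂ = conj ⟪f, mulBdd g hg (star Φ)⟫_ℂ := by
  rw [inner_conj_symm]
  refine inner_congr ?_
  filter_upwards [coeFn_mulBdd f hf Φ, coeFn_mulBdd g hg (star Φ), coeFn_star' Φ] with t h1 h2 h3
  rw [h1, h2, h3, map_mul, Complex.conj_conj]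
  ring

/-! ### The trigonometric basis -/

/-- The characters as elements of `L²`. -/
noncomputable abbrev e (n : ℤ) : L2 := fourierLp 2 n

theorem coeFn_e (n : ℤ) : ∀ᵐ t ∂m, e n t = fourier n t := coeFn_fourierLp 2 n

theorem e_bdd (n : ℤ) : MemLp (e n) ∞ m := by
  refine memLp_top_of_bound (Lp.aestronglyMeasurable _) 1 ?_
  filter_upwards [coeFn_e n] with t ht
  rw [ht, fourier_apply]
  exact (Circle.norm_coe _).le

theorem star_e (n : ℤ) : star (e n) = e (-n) := by
  apply Lp.ext
  filter_upwards [coeFn_star' (e n), coeFn_e n, coeFn_e (-n)] with t h1 h2 h3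
  rw [h1, h2, h3, fourier_neg]

theorem mulBdd_e_e (j n : ℤ) : mulBdd (e j) (e_bdd j) (e n) = e (j + n) := by
  apply Lp.ext
  filter_upwards [coeFn_mulBdd _ (e_bdd j) (e n), coeFn_e n, coeFn_e j, coeFn_e (j + n)]
    with t h1 h2 h3 h4
  rw [h1, h2, h3, h4, fourier_add]

theorem const_eq_smul (c : ℂ) : Lp.const 2 m c = c • e 0 := by
  apply Lp.ext
  filter_upwards [coeFn_e 0, Lp.coeFn_const (p := 2) (μ := m) c, Lp.coeFn_smul c (e 0)]
    with t h1 h2 h3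
  rw [h2, h3, Pi.smul_apply, h1, fourier_zero, Function.const_apply, smul_eq_mul, mul_one]

theorem mulBdd_mulBdd_e (j n : ℤ) (f : L2) :
    mulBdd (e j) (e_bdd j) (mulBdd (e n) (e_bdd n) f) = mulBdd (e (j + n)) (e_bdd _) f := by
  apply Lp.ext
  filter_upwards [coeFn_mulBdd _ (e_bdd j) (mulBdd (e n) (e_bdd n) f), coeFn_mulBdd _ (e_bdd n) f,
    coeFn_mulBdd _ (e_bdd (j + n)) f, coeFn_e n, coeFn_e j, coeFn_e (j + n)]
    with t h1 h2 h3 h4 h5 h6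
  rw [h1, h2, h3, h4, h5, h6, fourier_add, mul_assoc]

theorem mulBdd_e_zero (f : L2) : mulBdd (e 0) (e_bdd 0) f = f := by
  apply Lp.ext
  filter_upwards [coeFn_mulBdd _ (e_bdd 0) f, coeFn_e 0] with t h1 h2
  rw [h1, h2, fourier_zero, one_mul]

theorem mulBdd_apply_e_zero (b : L2) (hb : MemLp b ∞ m) : mulBdd b hb (e 0) = b := by
  apply Lp.ext
  filter_upwards [coeFn_mulBdd b hb (e 0), coeFn_e 0] with t h1 h2
  rw [h1, h2, fourier_zero, mul_one]

theorem inner_e_mul_left (j : ℤ) (f g : L2) :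
    ⟪mulBdd (e j) (e_bdd j) f, g⟫_ℂ = ⟪f, mulBdd (e (-j)) (e_bdd (-j)) g⟫_ℂ := by
  rw [inner_mulBdd_left]
  congr 1
  apply Lp.ext
  filter_upwards [coeFn_mulBdd _ (bdd_star (e_bdd j)) g, coeFn_mulBdd _ (e_bdd (-j)) g]
    with t h1 h2
  rw [h1, h2, star_e]

theorem inner_e_mul_right (j : ℤ) (f g : L2) :
    ⟪f, mulBdd (e j) (e_bdd j) g⟫_ℂ = ⟪mulBdd (e (-j)) (e_bdd (-j)) f, g⟫_ℂ := by
  rw [inner_e_mul_left, neg_neg]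

theorem inner_e_mulBdd_e (n j : ℤ) (f : L2) :
    ⟪e n, mulBdd (e j) (e_bdd j) f⟫_ℂ = ⟪e (n - j), f⟫_ℂ := by
  rw [inner_e_mul_right, mulBdd_e_e, neg_add_eq_sub]

theorem inner_e_star (n : ℤ) (f : L2) : ⟪e n, star f⟫_ℂ = conj ⟪e (-n), f⟫_ℂ := by
  rw [inner_conj_symm, ← inner_star_star, star_star, star_e]

theorem inner_e_e (n j : ℤ) : ⟪e n, e j⟫_ℂ = if n = j then 1 else 0 :=
  orthonormal_iff_ite.1 orthonormal_fourier n j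

theorem hasSum_inner_e (f g : L2) : HasSum (fun n : ℤ => ⟪f, e n⟫_ℂ * ⟪e n, g⟫_ℂ) ⟪f, g⟫_ℂ := by
  simpa [coe_fourierBasis] using (fourierBasis (T := 1)).hasSum_inner_mul_inner f g

theorem ext_inner_e {f g : L2} (h : ∀ n, ⟪e n, f⟫_ℂ = ⟪e n, g⟫_ℂ) : f = g := by
  refine ext_inner_left ℂ fun v => ?_
  refine (hasSum_inner_e v f).unique ?_
  simp only [h]
  exact hasSum_inner_e v g

theorem mem_H2_iff {f : L2} : f ∈ H2 ↔ ∀ n : ℤ, n < 0 → ⟪e n, f⟫_ℂ = 0 := by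
  refine forall₂_congr fun n _ => ?_
  rw [← fourierBasis_repr, HilbertBasis.repr_apply_apply, coe_fourierBasis]

theorem inner_eq_zero_of_mem_H2 {f g : L2} (hf : ∀ n : ℤ, 0 ≤ n → ⟪e n, f⟫_ℂ = 0)
    (hg : g ∈ H2) : ⟪f, g⟫_ℂ = 0 := by
  refine (hasSum_inner_e f g).unique ?_
  convert hasSum_zero using 2 with n
  rcases lt_or_ge n 0 with hn | hn
  · rw [mem_H2_iff.1 hg n hn, mul_zero]
  · rw [← inner_conj_symm, hf n hn, map_zero, zero_mul]

theorem e_mem_H2 {n : ℤ} (hn : 0 ≤ n) : e n ∈ H2 := by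
  refine mem_H2_iff.2 fun j hj => ?_
  rw [inner_e_e, if_neg (by omega)]

theorem mulBdd_e_mem_H2 {j : ℤ} (hj : 0 ≤ j) {f : L2} (hf : f ∈ H2) :
    mulBdd (e j) (e_bdd j) f ∈ H2 := by
  refine mem_H2_iff.2 fun n hn => ?_
  rw [inner_e_mulBdd_e]
  exact mem_H2_iff.1 hf _ (by omega)

/-! ### The backward shift -/

/-- The backward shift `f ↦ conj z (f - f̂(0))`. -/
noncomputable def backward (f : L2) : L2 := mulBdd (e (-1)) (e_bdd (-1)) (f - ⟪e 0, f⟫_ℂ • e 0)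

theorem backward_eq (f : L2) :
    backward f = mulBdd (e (-1)) (e_bdd (-1)) f - ⟪e 0, f⟫_ℂ • e (-1) := by
  rw [backward, mulBdd_sub, mulBdd_smul, mulBdd_e_e, add_zero]

theorem inner_e_backward (n : ℤ) (f : L2) :
    ⟪e n, backward f⟫_ℂ = if n = -1 then 0 else ⟪e (n + 1), f⟫_ℂ := by
  rw [backward_eq, inner_sub_right, inner_smul_right, inner_e_mulBdd_e, inner_e_e,
    sub_neg_eq_add]
  split_ifs with h
  · subst h; simp
  · simp

theorem backward_mem_H2 {f : L2} (hf : f ∈ H2) : backward f ∈ H2 := by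
  refine mem_H2_iff.2 fun n hn => ?_
  rw [inner_e_backward]
  split_ifs with h
  · rfl
  · exact mem_H2_iff.1 hf _ (by omega)

theorem backward_bdd {f : L2} (hf : MemLp f ∞ m) : MemLp (backward f) ∞ m := by
  have h1 : MemLp ((e (-1) : Torus → ℂ) * ((f : Torus → ℂ) - ⟪e 0, f⟫_ℂ • (e 0 : Torus → ℂ))) ∞ m :=
    (hf.sub ((e_bdd 0).const_smul _)).mul (e_bdd (-1))
  refine h1.ae_eq ?_
  filter_upwards [coeFn_mulBdd _ (e_bdd (-1)) (f - ⟪e 0, f⟫_ℂ • e 0),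
    Lp.coeFn_sub f (⟪e 0, f⟫_ℂ • e 0), Lp.coeFn_smul ⟪e 0, f⟫_ℂ (e 0)] with t h1 h2 h3
  rw [backward, h1, h2, Pi.sub_apply, h3]
  rfl

theorem inner_backward_left (f : L2) {g : L2} (hg : g ∈ H2) :
    ⟪backward f, g⟫_ℂ = ⟪f, mulBdd z z_bdd g⟫_ℂ := by
  rw [backward_eq, inner_sub_left, inner_smul_left, mem_H2_iff.1 hg (-1) (by norm_num), mul_zero,
    sub_zero, inner_e_mul_left]
  rfl

theorem inner_backward_backward (f g : L2) :
    ⟪backward f, backward g⟫_ℂ = ⟪f, g⟫_ℂ - conj ⟪e 0, f⟫_ℂ * ⟪e 0, g⟫_ℂ := by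
  rw [backward, backward, inner_e_mul_left, mulBdd_mulBdd_e, neg_neg, add_neg_cancel,
    mulBdd_e_zero]
  simp only [inner_sub_left, inner_sub_right, inner_smul_left, inner_smul_right, inner_e_e,
    if_true]
  rw [← inner_conj_symm f (e 0)]
  ring

theorem conj_mul_e (n : ℤ) : ∀ᵐ t ∂m, conj (e n t) * e n t = 1 := by
  filter_upwards [coeFn_e n] with t ht
  rw [ht, ← fourier_neg, ← fourier_add, neg_add_cancel, fourier_zero]

theorem conj_e_mul_conj_z (n : ℤ) : ∀ᵐ t ∂m, conj (e n t) * conj (z t) = e (-n - 1) t := by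
  filter_upwards [coeFn_e n, coeFn_e 1, coeFn_e (-n - 1)] with t h1 h2 h3
  rw [z, h1, h2, h3, ← fourier_neg, ← fourier_neg, ← fourier_add, sub_eq_add_neg]

/-! ### Inner functions and the model space -/

theorem InnerFunction.conj_mul (u : InnerFunction) :
    ∀ᵐ t ∂m, conj (u.toL2 t) * u.toL2 t = 1 := by
  filter_upwards [u.unimodular] with t ht
  rw [Complex.conj_mul', ht]
  norm_num

theorem mulBdd_unimodular_comm (u : InnerFunction) (n : ℤ) :
    mulBdd u.toL2 u.bdd (e n) = mulBdd (e n) (e_bdd n) u.toL2 := by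
  apply Lp.ext
  filter_upwards [coeFn_mulBdd _ u.bdd (e n), coeFn_mulBdd _ (e_bdd n) u.toL2] with t h1 h2
  rw [h1, h2, mul_comm]

theorem inner_e_mul_inner (u : InnerFunction) (n : ℤ) (f : L2) :
    ⟪mulBdd (e n) (e_bdd n) u.toL2, f⟫_ℂ =
      ⟪e n, mulBdd (star u.toL2) (bdd_star u.bdd) f⟫_ℂ := by
  rw [← mulBdd_unimodular_comm, inner_mulBdd_left]

theorem mem_K_iff {u : InnerFunction} {f : L2} :
    f ∈ K u ↔ f ∈ H2 ∧ ∀ n : ℤ, 0 ≤ n → ⟪mulBdd (e n) (e_bdd n) u.toL2, f⟫_ℂ = 0 := by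
  refine and_congr_right fun _ => ?_
  change f ∈ (uH2 u)ᗮ ↔ _
  rw [Submodule.mem_orthogonal]
  constructor
  · intro h n hn
    rw [← mulBdd_unimodular_comm]
    exact h _ ⟨e n, e_mem_H2 hn, rfl⟩
  · rintro h _ ⟨g, hg, rfl⟩
    rw [inner_mulBdd_left, ← inner_conj_symm, inner_eq_zero_of_mem_H2 _ hg, map_zero]
    intro n hn
    rw [← inner_e_mul_inner, h n hn]

theorem inner_P {u : InnerFunction} (g : K u) (w : L2) : ⟪g, P u w⟫_ℂ = ⟪(g : L2), w⟫_ℂ :=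
  Submodule.inner_orthogonalProjectionOnto_eq_of_mem_left g w

theorem inner_P_left {u : InnerFunction} (g : K u) (w : L2) : ⟪P u w, g⟫_ℂ = ⟪w, (g : L2)⟫_ℂ :=
  Submodule.inner_orthogonalProjectionOnto_eq_of_mem_right g w

theorem P_coe {u : InnerFunction} (g : K u) : P u (g : L2) = g :=
  Submodule.orthogonalProjectionOnto_mem_subspace_eq_self g

theorem inner_inner_function_eq_zero {u : InnerFunction} (f : K u) : ⟪u.toL2, (f : L2)⟫_ℂ = 0 := by
  have := (mem_K_iff.1 f.2).2 0 le_rfl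
  rwa [mulBdd_e_zero] at this

theorem inner_inner_function_eq_zero' {u : InnerFunction} (f : K u) : ⟪(f : L2), u.toL2⟫_ℂ = 0 := by
  rw [← inner_conj_symm, inner_inner_function_eq_zero, map_zero]

theorem inner_coe_P {u : InnerFunction} (g : K u) (w : L2) :
    ⟪(g : L2), (P u w : L2)⟫_ℂ = ⟪(g : L2), w⟫_ℂ := inner_P g w

/-! ### The conjugation -/

theorem coeFn_C (u : InnerFunction) (f : L2) :
    ∀ᵐ t ∂m, C u f t = u.toL2 t * (conj (z t) * conj (f t)) := by
  filter_upwards [coeFn_mulBdd _ u.bdd (star (mulBdd z z_bdd f)), coeFn_star' (mulBdd z z_bdd f),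
    coeFn_mulBdd _ z_bdd f] with t h1 h2 h3
  rw [C, h1, h2, h3, map_mul]

theorem C_bdd (u : InnerFunction) {f : L2} (hf : MemLp f ∞ m) : MemLp (C u f) ∞ m := by
  have h1 : MemLp ((u.toL2 : Torus → ℂ) * (star (z : Torus → ℂ) * star (f : Torus → ℂ))) ∞ m :=
    (hf.star.mul (z_bdd.star) (r := ∞)).mul u.bdd
  refine h1.ae_eq ?_
  filter_upwards [coeFn_C u f] with t h1
  rw [h1]
  rfl

theorem C_mem_K {u : InnerFunction} {f : L2} (hf : f ∈ K u) : C u f ∈ K u := by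
  rw [mem_K_iff] at hf ⊢
  constructor
  · refine mem_H2_iff.2 fun n hn => ?_
    rw [show ⟪e n, C u f⟫_ℂ = ⟪f, mulBdd (e (-n - 1)) (e_bdd _) u.toL2⟫_ℂ from ?_,
      ← inner_conj_symm, hf.2 _ (by omega), map_zero]
    refine inner_congr ?_
    filter_upwards [coeFn_C u f, conj_e_mul_conj_z n, coeFn_mulBdd _ (e_bdd (-n - 1)) u.toL2]
      with t h1 h2 h3
    rw [h1, h3, ← h2]
    ring
  · intro n hn
    rw [show ⟪mulBdd (e n) (e_bdd n) u.toL2, C u f⟫_ℂ = ⟪f, e (-n - 1)⟫_ℂ from ?_,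
      ← inner_conj_symm, mem_H2_iff.1 hf.1 _ (by omega), map_zero]
    refine inner_congr ?_
    filter_upwards [coeFn_C u f, conj_e_mul_conj_z n, coeFn_mulBdd _ (e_bdd n) u.toL2,
      u.conj_mul] with t h1 h2 h3 h4
    rw [h1, h3, ← h2, map_mul]
    linear_combination (conj (e n t) * conj (z t) * conj (f t)) * h4

theorem inner_C_C (u : InnerFunction) (f g : L2) : ⟪C u f, C u g⟫_ℂ = ⟪g, f⟫_ℂ := by
  refine inner_congr ?_
  filter_upwards [coeFn_C u f, coeFn_C u g, u.conj_mul, conj_mul_e 1] with t h1 h2 h3 h4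
  rw [h1, h2, map_mul, map_mul, Complex.conj_conj, Complex.conj_conj]
  change conj (z t) * z t = 1 at h4
  linear_combination (f t * conj (g t) * (conj (u.toL2 t) * u.toL2 t)) * h4
    + (f t * conj (g t)) * h3

theorem C_C (u : InnerFunction) (f : L2) : C u (C u f) = f := by
  apply Lp.ext
  filter_upwards [coeFn_C u f, coeFn_C u (C u f), u.conj_mul, conj_mul_e 1] with t h1 h2 h3 h4
  rw [h2, h1, map_mul, map_mul, Complex.conj_conj, Complex.conj_conj]
  change conj (z t) * z t = 1 at h4
  linear_combination (f t * (conj (u.toL2 t) * u.toL2 t)) * h4 + f t * h3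

theorem inner_z_mul_C (u : InnerFunction) (f g : L2) :
    ⟪g, mulBdd z z_bdd (C u f)⟫_ℂ = ⟪f, mulBdd z z_bdd (C u g)⟫_ℂ := by
  refine inner_congr ?_
  filter_upwards [coeFn_C u f, coeFn_C u g, coeFn_mulBdd _ z_bdd (C u f),
    coeFn_mulBdd _ z_bdd (C u g)] with t h1 h2 h3 h4
  rw [h3, h4, h1, h2]
  ring

theorem inner_C_comm (u : InnerFunction) (f g : L2) : ⟪g, C u f⟫_ℂ = ⟪f, C u g⟫_ℂ := by
  refine inner_congr ?_
  filter_upwards [coeFn_C u f, coeFn_C u g] with t h1 h2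
  rw [h1, h2]
  ring

/-- The conjugation as a conjugate-linear map of the model space. -/
noncomputable def conjugation (u : InnerFunction) : K u →ₗ⋆[ℂ] K u where
  toFun f := ⟨C u f, C_mem_K f.2⟩
  map_add' f g := by
    refine Subtype.ext (Lp.ext ?_)
    filter_upwards [coeFn_C u f, coeFn_C u g, coeFn_C u (f + g : L2), Lp.coeFn_add (f : L2) g,
      Lp.coeFn_add (C u f) (C u g)] with t h1 h2 h3 h4 h5
    refine h3.trans (Eq.trans ?_ h5.symm)
    rw [Pi.add_apply, h1, h2, h4, Pi.add_apply, map_add]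
    ring
  map_smul' c f := by
    refine Subtype.ext (Lp.ext ?_)
    filter_upwards [coeFn_C u f, coeFn_C u (c • f : L2), Lp.coeFn_smul c (f : L2),
      Lp.coeFn_smul (conj c) (C u f)] with t h1 h2 h3 h4
    refine h2.trans (Eq.trans ?_ h4.symm)
    rw [Pi.smul_apply, h1, h3, Pi.smul_apply, smul_eq_mul, smul_eq_mul, map_mul]
    ring

theorem coe_conjugation (u : InnerFunction) (f : K u) : (conjugation u f : L2) = C u f := rfl

/-! ### The compressed shift -/

/-- Multiplication by `z` as a bounded operator. -/
noncomputable def mulZ : L2 →L[ℂ] L2 :=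
  LinearIsometry.toContinuousLinearMap
    { toFun := mulBdd z z_bdd
      map_add' := mulBdd_add _ _
      map_smul' := mulBdd_smul _ _
      norm_map' := fun f => by
        have h : ⟪mulBdd z z_bdd f, mulBdd z z_bdd f⟫_ℂ = ⟪f, f⟫_ℂ := by
          refine inner_congr ?_
          filter_upwards [coeFn_mulBdd _ z_bdd f, conj_mul_e 1] with t h1 h2
          change conj (z t) * z t = 1 at h2
          rw [h1, map_mul]
          linear_combination (f t * conj (f t)) * h2
        change ‖mulBdd z z_bdd f‖ = ‖f‖
        rw [@norm_eq_sqrt_re_inner ℂ, h, ← norm_eq_sqrt_re_inner] }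

/-- The compressed shift as a bounded operator. -/
noncomputable def shift (u : InnerFunction) : K u →L[ℂ] K u := P u ∘L mulZ ∘L (K u).subtypeL

theorem inner_shift {u : InnerFunction} (g f : K u) :
    ⟪g, shift u f⟫_ℂ = ⟪(g : L2), mulBdd z z_bdd f⟫_ℂ := inner_P g _

/-- The backward shift raises the index: ⟨zⁿu, backward f⟩ = ⟨zⁿ⁺¹u, f⟩. Asking only for n ≥ 1
admits f = u, which is not in K_u. -/
theorem backward_mem_K {u : InnerFunction} {f : L2} (hf : f ∈ H2)
    (h : ∀ n : ℤ, 1 ≤ n → ⟪mulBdd (e n) (e_bdd n) u.toL2, f⟫_ℂ = 0) : backward f ∈ K u := by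
  refine mem_K_iff.2 ⟨backward_mem_H2 hf, fun n hn => ?_⟩
  rw [← inner_conj_symm, inner_backward_left _ (mulBdd_e_mem_H2 hn u.mem_H2)]
  change conj ⟪f, mulBdd (e 1) (e_bdd 1) _⟫_ℂ = 0
  rw [mulBdd_mulBdd_e, inner_conj_symm, h _ (by omega)]

theorem coe_adjoint_shift {u : InnerFunction} (f : K u) : (((shift u)†) f : L2) = backward f := by
  have hmem : backward (f : L2) ∈ K u :=
    backward_mem_K (mem_K_iff.1 f.2).1 fun n hn => (mem_K_iff.1 f.2).2 n (by omega)
  refine congrArg Subtype.val (?_ : ((shift u)†) f = ⟨backward f, hmem⟩)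
  refine ext_inner_right ℂ fun g => ?_
  rw [ContinuousLinearMap.adjoint_inner_left, inner_shift, Submodule.coe_inner,
    inner_backward_left _ (mem_K_iff.1 g.2).1]

/-- ⟨g, z C f⟩ is the integral of u · conj(f g), hence symmetric in f and g. -/
theorem shift_conjugation (u : InnerFunction) (f : K u) :
    shift u (conjugation u f) = conjugation u (((shift u)†) f) := by
  refine ext_inner_left ℂ fun g => ?_
  rw [inner_shift, Submodule.coe_inner, coe_conjugation, coe_conjugation, coe_adjoint_shift,
    inner_C_comm, inner_backward_left _ (mem_K_iff.1 (C_mem_K g.2)).1, inner_z_mul_C]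

theorem shift_adjoint_shift (u : InnerFunction) (f : K u) :
    shift u (((shift u)†) f) = f - ⟪P u (e 0), f⟫_ℂ • P u (e 0) := by
  refine ext_inner_left ℂ fun g => ?_
  rw [← ContinuousLinearMap.adjoint_inner_left, Submodule.coe_inner, coe_adjoint_shift,
    coe_adjoint_shift, inner_backward_backward, inner_P_left, Submodule.coe_inner, Submodule.coe_sub,
    Submodule.coe_smul, inner_sub_right, inner_smul_right, inner_coe_P, inner_conj_symm, mul_comm]

theorem coe_P_one (u : InnerFunction) :
    (P u (e 0) : L2) = e 0 - conj ⟪e 0, u.toL2⟫_ℂ • u.toL2 := by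
  have hmem : e 0 - conj ⟪e 0, u.toL2⟫_ℂ • u.toL2 ∈ K u := by
    refine mem_K_iff.2 ⟨sub_mem (e_mem_H2 le_rfl) (H2.smul_mem _ u.mem_H2), fun n hn => ?_⟩
    have h1 : ⟪mulBdd (e n) (e_bdd n) u.toL2, u.toL2⟫_ℂ = ⟪e n, e 0⟫_ℂ := by
      refine inner_congr ?_
      filter_upwards [coeFn_mulBdd _ (e_bdd n) u.toL2, u.conj_mul, coeFn_e 0] with t h1 h2 h3
      rw [h1, h3, fourier_zero, map_mul]
      linear_combination conj (e n t) * h2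
    rw [inner_sub_right, inner_smul_right, h1, ← inner_conj_symm, inner_e_mulBdd_e, inner_e_e]
    rcases hn.eq_or_lt with rfl | hn
    · simp
    · rw [if_neg hn.ne', mem_H2_iff.1 u.mem_H2 _ (by omega)]
      simp
  refine congrArg Subtype.val (?_ : P u (e 0) = ⟨_, hmem⟩)
  refine ext_inner_left ℂ fun g => ?_
  rw [inner_P, Submodule.coe_inner, inner_sub_right, inner_smul_right, inner_inner_function_eq_zero',
    mul_zero, sub_zero]

/-- z · C k = u - û(0), and u is orthogonal to K_u. -/
theorem shift_conjugation_P_one (u : InnerFunction) :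
    shift u (conjugation u (P u (e 0))) = -(⟪e 0, u.toL2⟫_ℂ • P u (e 0)) := by
  have h : mulBdd z z_bdd (C u (P u (e 0))) = u.toL2 - ⟪e 0, u.toL2⟫_ℂ • e 0 := by
    rw [coe_P_one]
    set a := ⟪e 0, u.toL2⟫_ℂ
    apply Lp.ext
    filter_upwards [coeFn_mulBdd z z_bdd (C u (e 0 - conj a • u.toL2)),
      coeFn_C u (e 0 - conj a • u.toL2), Lp.coeFn_sub (e 0) (conj a • u.toL2),
      Lp.coeFn_smul (conj a) u.toL2, Lp.coeFn_sub u.toL2 (a • e 0), Lp.coeFn_smul a (e 0),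
      coeFn_e 0, u.conj_mul, conj_mul_e 1] with t h1 h2 h3 h4 h5 h6 h7 h8 h9
    change conj (z t) * z t = 1 at h9
    rw [h1, h2, h3, h5, Pi.sub_apply, Pi.sub_apply, h4, h6, Pi.smul_apply, Pi.smul_apply, h7,
      fourier_zero, map_sub, map_one, smul_eq_mul, smul_eq_mul, map_mul, Complex.conj_conj]
    linear_combination (u.toL2 t * (1 - a * conj (u.toL2 t))) * h9 - a * h8
  refine ext_inner_left ℂ fun g => ?_
  rw [inner_shift, coe_conjugation, h, Submodule.coe_inner, Submodule.coe_neg, Submodule.coe_smul,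
    inner_sub_right, inner_neg_right, inner_smul_right, inner_smul_right, inner_coe_P,
    inner_inner_function_eq_zero', zero_sub]

theorem P_one_ne_zero {u : InnerFunction} (hu : ¬ u.IsConstant) : P u (e 0) ≠ 0 := by
  intro h
  have h1 := coe_P_one u
  rw [h, ZeroMemClass.coe_zero] at h1
  set a := conj ⟪e 0, u.toL2⟫_ℂ
  have h2 : e 0 = a • u.toL2 := (sub_eq_zero.1 h1.symm)
  have ha0 : a ≠ 0 := by
    intro h0
    rw [h0, zero_smul] at h2
    have := inner_e_e 0 0
    rw [h2] at this
    simp at this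
  refine hu ⟨a⁻¹, ?_⟩
  rw [const_eq_smul, h2, smul_smul, inv_mul_cancel₀ ha0, one_smul]

/-- The compressed shift of a model space with its conjugation. -/
noncomputable def modelShift (u : InnerFunction) (hu : ¬ u.IsConstant) :
    ConjugatedShift (K u) where
  S := shift u
  C := conjugation u
  k := P u (e 0)
  a := ⟪e 0, u.toL2⟫_ℂ
  C_C f := Subtype.ext (C_C u f)
  inner_C_C f g := inner_C_C u f g
  S_C := shift_conjugation u
  S_adjoint := shift_adjoint_shift u
  S_C_k := shift_conjugation_P_one u
  k_ne := P_one_ne_zero hu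

/-! ### Iterates of the backward shift -/

theorem inner_backward_iterate (f : L2) (n : ℕ) {g : L2} (hg : g ∈ H2) :
    ⟪backward^[n] f, g⟫_ℂ = ⟪f, mulBdd (e n) (e_bdd n) g⟫_ℂ := by
  induction n generalizing g with
  | zero => simp [mulBdd_e_zero]
  | succ n ih =>
    rw [Function.iterate_succ_apply', inner_backward_left _ hg]
    refine (ih (mulBdd_e_mem_H2 zero_le_one hg)).trans ?_
    rw [mulBdd_mulBdd_e]
    rfl

theorem inner_e_zero_backward_iterate (f : L2) (n : ℕ) :
    ⟪e 0, backward^[n] f⟫_ℂ = ⟪e n, f⟫_ℂ := by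
  rw [← inner_conj_symm, inner_backward_iterate _ _ (e_mem_H2 le_rfl), mulBdd_e_e, add_zero,
    inner_conj_symm]

theorem hasSum_inner_e_nat {f g : L2} (hg : g ∈ H2) :
    HasSum (fun n : ℕ => ⟪f, e n⟫_ℂ * ⟪e n, g⟫_ℂ) ⟪f, g⟫_ℂ := by
  refine ((Nat.cast_injective (R := ℤ)).hasSum_iff fun n hn => ?_).2 (hasSum_inner_e f g)
  rw [mem_H2_iff.1 hg n, mul_zero]
  by_contra! h
  exact hn ⟨n.toNat, Int.toNat_of_nonneg h⟩

theorem inner_backward_iterate_self (f : L2) (n : ℕ) :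
    ⟪backward^[n] f, backward^[n] f⟫_ℂ =
      ⟪f, f⟫_ℂ - ∑ j ∈ Finset.range n, ⟪f, e j⟫_ℂ * ⟪e j, f⟫_ℂ := by
  induction n with
  | zero => simp
  | succ n ih =>
    rw [Function.iterate_succ_apply', inner_backward_backward, ih, Finset.sum_range_succ,
      inner_e_zero_backward_iterate, inner_conj_symm]
    ring

/-- The squared norm of the n-th iterate is a tail of the Parseval sum of f. -/
theorem tendsto_backward_iterate {f : L2} (hf : f ∈ H2) :
    Tendsto (fun n => backward^[n] f) atTop (𝓝 0) := by
  have h1 : Tendsto (fun n => ⟪backward^[n] f, backward^[n] f⟫_ℂ) atTop (𝓝 0) := by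
    simp only [inner_backward_iterate_self]
    simpa using (tendsto_const_nhds (x := ⟪f, f⟫_ℂ)).sub
      (hasSum_inner_e_nat (f := f) hf).tendsto_sum_nat
  rw [tendsto_zero_iff_norm_tendsto_zero]
  have h2 : Tendsto (fun n => √(⟪backward^[n] f, backward^[n] f⟫_ℂ).re) atTop (𝓝 0) := by
    have h := ((Real.continuous_sqrt.comp Complex.continuous_re).tendsto 0).comp h1
    rwa [Function.comp_apply, Complex.zero_re, Real.sqrt_zero] at h
  refine h2.congr fun n => ?_
  exact (norm_eq_sqrt_re_inner (𝕜 := ℂ) _).symm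

/-! ### Density of the bounded functions -/

theorem backward_iterate_bdd {f : L2} (hf : MemLp f ∞ m) (n : ℕ) :
    MemLp (backward^[n] f) ∞ m := by
  induction n with
  | zero => exact hf
  | succ n ih =>
    rw [Function.iterate_succ_apply']
    exact backward_bdd ih

theorem backward_iterate_inner_mem_K (u : InnerFunction) (n : ℕ) :
    backward^[n + 1] u.toL2 ∈ K u := by
  induction n with
  | zero =>
    refine backward_mem_K u.mem_H2 fun n hn => ?_
    rw [show ⟪mulBdd (e n) (e_bdd n) u.toL2, u.toL2⟫_ℂ = ⟪e n, e 0⟫_ℂ from ?_, inner_e_e,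
      if_neg (by omega)]
    refine inner_congr ?_
    filter_upwards [coeFn_mulBdd _ (e_bdd n) u.toL2, u.conj_mul, coeFn_e 0] with t h1 h2 h3
    rw [h1, h3, fourier_zero, map_mul]
    linear_combination conj (e n t) * h2
  | succ n ih =>
    rw [Function.iterate_succ_apply']
    rw [mem_K_iff] at ih
    exact backward_mem_K ih.1 fun n hn => ih.2 n (by omega)

/-- The bounded functions of the model space. -/
def boundedFunctions (u : InnerFunction) : Submodule ℂ (K u) where
  carrier := {f | MemLp (f : L2) ∞ m}
  zero_mem' := MemLp.zero.ae_eq (Lp.coeFn_zero ℂ 2 m).symm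
  add_mem' {f g} hf hg := (MemLp.add hf hg).ae_eq (Lp.coeFn_add (f : L2) g).symm
  smul_mem' c f hf := (MemLp.const_smul hf c).ae_eq (Lp.coeFn_smul c (f : L2)).symm

/-- The iterated backward shifts of u are bounded elements of K_u. If x ∈ K_u is orthogonal to them,
the Fourier coefficients of conj(u) x of negative index vanish; the others vanish because x ∈ K_u.
Hence conj(u) x = 0 and x = 0. -/
theorem dense_bounded (u : InnerFunction) : Dense {f : K u | MemLp (f : L2) ∞ m} := by
  change Dense (boundedFunctions u : Set (K u))
  rw [Submodule.dense_iff_topologicalClosure_eq_top, Submodule.topologicalClosure_eq_top_iff,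
    Submodule.eq_bot_iff]
  intro x hx
  rw [Submodule.mem_orthogonal] at hx
  obtain ⟨hx1, hx2⟩ := mem_K_iff.1 x.2
  have h1 : ∀ n : ℤ, ⟪mulBdd (e n) (e_bdd n) u.toL2, (x : L2)⟫_ℂ = 0 := by
    intro n
    rcases le_or_gt 0 n with hn | hn
    · exact hx2 n hn
    · obtain ⟨j, rfl⟩ : ∃ j : ℕ, n = -((j + 1 : ℕ) : ℤ) := ⟨(-n - 1).toNat, by omega⟩
      rw [inner_e_mul_left, neg_neg, ← inner_backward_iterate _ _ hx1]
      exact hx ⟨_, backward_iterate_inner_mem_K u j⟩ (backward_iterate_bdd u.bdd _)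
  have h2 : mulBdd (star u.toL2) (bdd_star u.bdd) (x : L2) = 0 := by
    refine ext_inner_e fun n => ?_
    rw [← inner_e_mul_inner, h1, inner_zero_right]
  have h3 : ⟪(x : L2), (x : L2)⟫_ℂ = ⟪mulBdd (star u.toL2) (bdd_star u.bdd) (x : L2),
      mulBdd (star u.toL2) (bdd_star u.bdd) (x : L2)⟫_ℂ := by
    refine inner_congr ?_
    filter_upwards [coeFn_mulBdd _ (bdd_star u.bdd) (x : L2), u.conj_mul, coeFn_star' u.toL2]
      with t h1 h2 h3
    rw [h1, h3, map_mul, Complex.conj_conj]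
    linear_combination -(conj ((x : L2) t) * (x : L2) t) * h2
  rw [h2, inner_zero_left, inner_self_eq_zero] at h3
  exact Subtype.ext h3

/-! ### Operators and their symbols -/

variable {u : InnerFunction} {A B : K u →L[ℂ] K u} {Φ Ψ : L2}

theorem HasSymbol.inner (h : HasSymbol u A Φ) {f : K u} (hf : MemLp (f : L2) ∞ m) (g : K u) :
    ⟪g, A f⟫_ℂ = ⟪(g : L2), mulBdd (f : L2) hf Φ⟫_ℂ := by
  rw [h f hf, truncatedToeplitz, inner_P]

theorem hasSymbol_of_inner (h : ∀ (f g : K u) (hf : MemLp (f : L2) ∞ m), MemLp (g : L2) ∞ m →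
    ⟪g, A f⟫_ℂ = ⟪(g : L2), mulBdd (f : L2) hf Φ⟫_ℂ) : HasSymbol u A Φ := by
  intro f hf
  refine (dense_bounded u).eq_of_inner_right ℂ fun g hg => ?_
  rw [h f g hf hg, truncatedToeplitz, inner_P]

theorem HasSymbol.add (hA : HasSymbol u A Φ) (hB : HasSymbol u B Ψ) :
    HasSymbol u (A + B) (Φ + Ψ) := by
  intro f hf
  rw [add_apply, hA f hf, hB f hf, truncatedToeplitz, truncatedToeplitz, truncatedToeplitz,
    mulBdd_add, map_add]

theorem HasSymbol.smul (hA : HasSymbol u A Φ) (c : ℂ) : HasSymbol u (c • A) (c • Φ) := by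
  intro f hf
  rw [smul_apply, hA f hf, truncatedToeplitz, truncatedToeplitz, mulBdd_smul, map_smul]

theorem hasSymbol_id (c : ℂ) :
    HasSymbol u (c • ContinuousLinearMap.id ℂ (K u)) (Lp.const 2 m c) := by
  intro f hf
  rw [truncatedToeplitz, const_eq_smul, mulBdd_smul, mulBdd_apply_e_zero, map_smul, P_coe]
  rfl

theorem HasSymbol.sub_const (hA : HasSymbol u A Φ) (c : ℂ) :
    HasSymbol u (A - c • ContinuousLinearMap.id ℂ (K u)) (Φ - Lp.const 2 m c) := by
  convert hA.add ((hasSymbol_id (u := u) c).smul (-1)) using 1 <;> module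

/-! ### Sarason's criterion -/

variable (hu : ¬ u.IsConstant)

/-- ⟨g, A C f⟩ is the integral of Φ u · conj(z f g), symmetric in f and g. -/
theorem HasSymbol.cSymm (h : HasSymbol u A Φ) : (modelShift u hu).CSymm A := by
  refine ConjugatedShift.cSymm_of_dense (dense_bounded u) fun f hf g hg => ?_
  rw [h.inner (f := (modelShift u hu).C f) (C_bdd u hf),
    h.inner (f := (modelShift u hu).C g) (C_bdd u hg)]
  change ⟪_, mulBdd (C u f) _ Φ⟫_ℂ = ⟪_, mulBdd (C u g) _ Φ⟫_ℂ
  refine inner_congr ?_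
  filter_upwards [coeFn_mulBdd _ (C_bdd u hf) Φ, coeFn_mulBdd _ (C_bdd u hg) Φ, coeFn_C u f,
    coeFn_C u g] with t h1 h2 h3 h4
  rw [h1, h2, h3, h4]
  ring

theorem mulBdd_backward {f : L2} (hf : MemLp f ∞ m) (Φ : L2) :
    mulBdd (backward f) (backward_bdd hf) Φ =
      mulBdd (e (-1)) (e_bdd (-1)) (mulBdd f hf Φ - ⟪e 0, f⟫_ℂ • Φ) := by
  apply Lp.ext
  filter_upwards [coeFn_mulBdd _ (backward_bdd hf) Φ,
    coeFn_mulBdd _ (e_bdd (-1)) (mulBdd f hf Φ - ⟪e 0, f⟫_ℂ • Φ),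
    coeFn_mulBdd _ (e_bdd (-1)) (f - ⟪e 0, f⟫_ℂ • e 0),
    Lp.coeFn_sub f (⟪e 0, f⟫_ℂ • e 0), Lp.coeFn_smul ⟪e 0, f⟫_ℂ (e 0),
    Lp.coeFn_sub (mulBdd f hf Φ) (⟪e 0, f⟫_ℂ • Φ), Lp.coeFn_smul ⟪e 0, f⟫_ℂ Φ,
    coeFn_mulBdd f hf Φ, coeFn_e 0] with t h1 h2 h3 h4 h5 h6 h7 h8 h9
  rw [h1, h2, backward, h3, h4, h6, Pi.sub_apply, Pi.sub_apply, h5, h7, Pi.smul_apply,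
    Pi.smul_apply, h8, h9, fourier_zero, smul_eq_mul, smul_eq_mul]
  ring

/-- On bounded f, g, the form of S A S* is ⟨g - ĝ(0), (f - f̂(0))Φ⟩, the two factors conj z
cancelling. In its difference from ⟨g, fΦ⟩ the mean of Φ enters through both Φ and conj Φ, whence
the correction by ⟨1, Φ⟩. -/
theorem HasSymbol.rep (h : HasSymbol u A Φ) :
    (modelShift u hu).Rep A (P u Φ - ⟪e 0, Φ⟫_ℂ • P u (e 0)) (P u (star Φ)) := by
  refine ConjugatedShift.rep_of_dense (dense_bounded u) fun f hf g hg => ?_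
  replace hf : MemLp (f : L2) ∞ m := hf
  change ⟪g, A f - shift u (A (((shift u)†) f))⟫_ℂ =
    ⟪g, ⟪P u (e 0), f⟫_ℂ • (P u Φ - ⟪e 0, Φ⟫_ℂ • P u (e 0)) + ⟪P u (star Φ), f⟫_ℂ • P u (e 0)⟫_ℂ
  have hf' : MemLp ((((shift u)†) f : K u) : L2) ∞ m := by
    rw [coe_adjoint_shift]; exact backward_bdd hf
  have h1 : mulBdd ((((shift u)†) f : K u) : L2) hf' Φ =
      mulBdd (backward f) (backward_bdd hf) Φ := by
    congr 1; exact coe_adjoint_shift f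
  have h2 : ⟪e 0, mulBdd (f : L2) hf Φ⟫_ℂ = ⟪star Φ, (f : L2)⟫_ℂ := by
    refine inner_congr ?_
    filter_upwards [coeFn_mulBdd _ hf Φ, coeFn_star' Φ, coeFn_e 0] with t h1 h2 h3
    rw [h1, h2, h3, fourier_zero, map_one, Complex.conj_conj]
    ring
  rw [inner_sub_right, ← ContinuousLinearMap.adjoint_inner_left (shift u), h.inner hf,
    h.inner hf', h1, mulBdd_backward hf, coe_adjoint_shift, backward, inner_e_mul_left,
    mulBdd_mulBdd_e, neg_neg, add_neg_cancel, mulBdd_e_zero]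
  rw [inner_P_left, inner_P_left, Submodule.coe_inner]
  simp only [Submodule.coe_add, Submodule.coe_smul, Submodule.coe_sub, inner_sub_right,
    inner_sub_left, inner_add_right, inner_smul_left, inner_smul_right, inner_coe_P, h2,
    inner_conj_symm]
  ring

theorem ConjugatedShift.Rep.telescope {H : Type*} [NormedAddCommGroup H] [InnerProductSpace ℂ H]
    [CompleteSpace H] {M : ConjugatedShift H} {A : H →L[ℂ] H} {φ χ : H} (hA : M.Rep A φ χ)
    (f g : H) (n : ℕ) :
    ⟪g, A f⟫_ℂ = ⟪(M.S†)^[n] g, A ((M.S†)^[n] f)⟫_ℂ +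
      ∑ j ∈ Finset.range n, (⟪M.k, (M.S†)^[j] f⟫_ℂ * ⟪(M.S†)^[j] g, φ⟫_ℂ +
        ⟪χ, (M.S†)^[j] f⟫_ℂ * ⟪(M.S†)^[j] g, M.k⟫_ℂ) := by
  induction n with
  | zero => simp
  | succ n ih =>
    have h := congrArg (fun v => ⟪(M.S†)^[n] g, v⟫_ℂ) (hA ((M.S†)^[n] f))
    simp only [inner_sub_right, inner_add_right, inner_smul_right] at h
    rw [← ContinuousLinearMap.adjoint_inner_left M.S] at h
    rw [ih, Finset.sum_range_succ, Function.iterate_succ_apply', Function.iterate_succ_apply']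
    linear_combination h

theorem hasSum_symbol {f g : L2} (hf2 : f ∈ H2) (hf : MemLp f ∞ m) (hg : MemLp g ∞ m) (φ : L2) :
    HasSum (fun j : ℕ => ⟪e j, f⟫_ℂ * ⟪g, mulBdd (e j) (e_bdd j) φ⟫_ℂ) ⟪g, mulBdd f hf φ⟫_ℂ := by
  have h := hasSum_inner_e_nat (f := mulBdd g hg (star φ)) hf2
  convert h using 1
  · funext j
    rw [mul_comm]
    congr 1
    refine inner_congr ?_
    filter_upwards [coeFn_mulBdd _ hg (star φ), coeFn_mulBdd _ (e_bdd j) φ, coeFn_star' φ]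
      with t h1 h2 h3
    rw [h1, h2, h3, map_mul, Complex.conj_conj]
    ring
  · refine inner_congr ?_
    filter_upwards [coeFn_mulBdd _ hg (star φ), coeFn_mulBdd _ hf φ, coeFn_star' φ]
      with t h1 h2 h3
    rw [h1, h2, h3, map_mul, Complex.conj_conj]
    ring

theorem coe_adjoint_shift_iterate (f : K u) (n : ℕ) :
    ((((shift u)†)^[n] f : K u) : L2) = backward^[n] f := by
  induction n with
  | zero => rfl
  | succ n ih =>
    rw [Function.iterate_succ_apply', Function.iterate_succ_apply', coe_adjoint_shift, ih]

theorem tendsto_adjoint_shift_iterate (f : K u) :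
    Tendsto (fun n => ((shift u)†)^[n] f) atTop (𝓝 0) := by
  rw [tendsto_subtype_rng]
  simp only [coe_adjoint_shift_iterate]
  exact tendsto_backward_iterate (mem_K_iff.1 f.2).1

variable {hu} in
-- Iterate the displacement equation: the remainder vanishes since S*ⁿ → 0 strongly and A is
-- bounded, and the sums are the power series expansions of ⟨g, fφ⟩ (in f) and ⟨g, f conj χ⟩ (in g).
theorem hasSymbol_of_rep {φ χ : K u} (h : (modelShift u hu).Rep A φ χ) :
    HasSymbol u A ((φ : L2) + star (χ : L2)) := by
  refine hasSymbol_of_inner fun f g hf hg => ?_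
  have hK2 : ∀ x : K u, (x : L2) ∈ H2 := fun x => (mem_K_iff.1 x.2).1
  have h1 : Tendsto (fun n => ⟪((shift u)†)^[n] g, A (((shift u)†)^[n] f)⟫_ℂ) atTop (𝓝 0) := by
    have h2 := (tendsto_adjoint_shift_iterate g).inner (𝕜 := ℂ)
      ((A.continuous.tendsto 0).comp (tendsto_adjoint_shift_iterate f))
    rwa [inner_zero_left] at h2
  have h2 := (hasSum_symbol (hK2 f) hf hg φ).add
    (Complex.hasSum_conj'.2 (hasSum_symbol (hK2 g) hg hf χ))
  have h3 := h1.add h2.tendsto_sum_nat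
  rw [zero_add] at h3
  have h4 : ⟪(f : L2), mulBdd (g : L2) hg χ⟫_ℂ =
      conj ⟪(g : L2), mulBdd (f : L2) hf (star (χ : L2))⟫_ℂ := by
    rw [inner_mulBdd_swap hg hf]
  rw [mulBdd_add, inner_add_right]
  rw [h4, Complex.conj_conj] at h3
  refine tendsto_nhds_unique (Tendsto.congr (fun n => ?_) tendsto_const_nhds) h3
  rw [h.telescope f g n]
  congr 1
  refine Finset.sum_congr rfl fun j _ => ?_
  change ⟪P u (e 0), ((shift u)†)^[j] f⟫_ℂ * ⟪((shift u)†)^[j] g, φ⟫_ℂ +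
    ⟪χ, ((shift u)†)^[j] f⟫_ℂ * ⟪((shift u)†)^[j] g, P u (e 0)⟫_ℂ = _
  rw [inner_P_left, inner_P, ← inner_conj_symm χ, Submodule.coe_inner, Submodule.coe_inner,
    coe_adjoint_shift_iterate, coe_adjoint_shift_iterate, inner_e_zero_backward_iterate,
    ← inner_conj_symm _ (e 0), inner_e_zero_backward_iterate, inner_backward_iterate _ _ (hK2 _),
    inner_backward_iterate _ _ (hK2 _), map_mul, mul_comm (conj ⟪(f : L2), _⟫_ℂ)]

/-- conj ψ has no coefficients of positive index, so only its constant term pairs with K_u. -/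
theorem P_star_of_mem_H2 {ψ : L2} (hψ : ψ ∈ H2) :
    P u (star ψ) = ⟪e 0, star ψ⟫_ℂ • P u (e 0) := by
  refine ext_inner_left ℂ fun g => ?_
  have h : ⟪star ψ - ⟪e 0, star ψ⟫_ℂ • e 0, (g : L2)⟫_ℂ = 0 := by
    refine inner_eq_zero_of_mem_H2 (fun n hn => ?_) (mem_K_iff.1 g.2).1
    rw [inner_sub_right, inner_smul_right, inner_e_e]
    rcases hn.eq_or_lt with rfl | hn
    · simp
    · rw [if_neg hn.ne', mul_zero, sub_zero, inner_e_star, mem_H2_iff.1 hψ _ (by omega), map_zero]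
  have h' : ⟪(g : L2), star ψ - ⟪e 0, star ψ⟫_ℂ • e 0⟫_ℂ = 0 := by
    rw [← inner_conj_symm, h, map_zero]
  rw [inner_sub_right, inner_smul_right, sub_eq_zero] at h'
  rw [inner_P, h', Submodule.coe_inner, Submodule.coe_smul, inner_smul_right, inner_coe_P]

variable {hu} in
theorem rep_iff_hasSymbol {φ χ : K u} :
    (modelShift u hu).Rep A φ χ ↔ HasSymbol u A ((φ : L2) + star (χ : L2)) := by
  refine ⟨hasSymbol_of_rep, fun h => ?_⟩
  have h2 := h.rep hu
  set a := ⟪e 0, (φ : L2)⟫_ℂ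
  have e1 : P u ((φ : L2) + star (χ : L2)) - ⟪e 0, (φ : L2) + star (χ : L2)⟫_ℂ • P u (e 0) =
      φ - a • P u (e 0) := by
    rw [map_add, inner_add_right, P_star_of_mem_H2 (mem_K_iff.1 χ.2).1, P_coe]
    module
  have e2 : P u (star ((φ : L2) + star (χ : L2))) = χ + conj a • P u (e 0) := by
    have : star ((φ : L2) + star (χ : L2)) = star (φ : L2) + χ := by
      apply Lp.ext
      filter_upwards [coeFn_star' ((φ : L2) + star (χ : L2)), Lp.coeFn_add (φ : L2) (star (χ : L2)),
        Lp.coeFn_add (star (φ : L2)) (χ : L2), coeFn_star' (φ : L2), coeFn_star' (χ : L2)]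
        with t h1 h2 h3 h4 h5
      rw [h1, h2, h3, Pi.add_apply, Pi.add_apply, h4, h5, map_add, Complex.conj_conj]
    rw [this, map_add, P_star_of_mem_H2 (mem_K_iff.1 φ.2).1, P_coe, inner_e_star, neg_zero, add_comm]
  rw [e1, e2] at h2
  -- `HasSymbol.rep` returns the given pair up to a multiple of k ⊗ k, with coefficient the mean of
  -- φ.
  have h3 := h2.gauge (-a)
  convert h3 using 1
  · change φ = φ - a • P u (e 0) - (-a) • P u (e 0)
    module
  · change χ = χ + conj a • P u (e 0) + conj (-a) • P u (e 0)
    rw [map_neg]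
    module

/-! ### Types in the model space -/

theorem star_smul_L2 (c : ℂ) (f : L2) : star (c • f) = conj c • star f := by
  apply Lp.ext
  filter_upwards [coeFn_star' (c • f), Lp.coeFn_smul c f, Lp.coeFn_smul (conj c) (star f),
    coeFn_star' f] with t h1 h2 h3 h4
  rw [h1, h2, h3, Pi.smul_apply, Pi.smul_apply, h4, smul_eq_mul, smul_eq_mul, map_mul]

theorem isOfType_coe_iff {α : ℂ} :
    IsOfType u A (α : OnePoint ℂ) ↔ (modelShift u hu).FiniteType A α := by
  refine exists_congr fun φ => exists_congr fun c => ?_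
  rw [rep_iff_hasSymbol]
  have h : star ((conj α • (modelShift u hu).S ((modelShift u hu).C φ) : K u) : L2) =
      α • star (S u (C u (φ : L2)) : L2) := by
    rw [Submodule.coe_smul, star_smul_L2, Complex.conj_conj]
    rfl
  rw [h]
  constructor
  · intro hs
    simpa using hs.sub_const c
  · intro hs
    simpa using hs.add (hasSymbol_id c)

theorem isOfType_infty_iff :
    IsOfType u A OnePoint.infty ↔ (modelShift u hu).InfiniteType A := by
  constructor
  · rintro ⟨ψ, hψ, h⟩
    have h1 := h.rep hu
    rw [P_star_of_mem_H2 hψ, sub_self] at h1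
    exact ⟨_, h1⟩
  · rintro ⟨χ, h⟩
    refine ⟨χ, (mem_K_iff.1 χ.2).1, ?_⟩
    simpa using hasSymbol_of_rep h

variable {hu} in
-- An operator with vanishing defect has symbol 0, so it vanishes on the dense set of bounded
-- functions.
theorem eq_smul_id_of_rep {c : ℂ}
    (h : (modelShift u hu).Rep (A - c • ContinuousLinearMap.id ℂ (K u)) 0 0) :
    A = c • ContinuousLinearMap.id ℂ (K u) := by
  have h1 := (hasSymbol_of_rep h).add (hasSymbol_id c)
  rw [sub_add_cancel] at h1
  refine ContinuousLinearMap.ext fun x => congrFun (Continuous.ext_on (dense_bounded u)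
    A.continuous (c • ContinuousLinearMap.id ℂ (K u)).continuous fun f hf => ?_) x
  rw [h1 f hf, hasSymbol_id c f hf]
  congr 1
  have : star (0 : L2) = 0 := by simpa using star_smul_L2 0 0
  rw [ZeroMemClass.coe_zero, this, zero_add, zero_add]

end TTO

theorem mainTheorem1 (u : TTO.InnerFunction) (hu : ¬ u.IsConstant)
    (Φ Ψ : TTO.L2) (AΦ AΨ : TTO.K u →L[ℂ] TTO.K u)
    (hΦ : TTO.HasSymbol u AΦ Φ) (hΨ : TTO.HasSymbol u AΨ Ψ) :
    (TTO.IsTTO u (AΦ ∘L AΨ) ↔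
      ((∃ c : ℂ, AΦ = c • ContinuousLinearMap.id ℂ (TTO.K u)) ∨
        (∃ c : ℂ, AΨ = c • ContinuousLinearMap.id ℂ (TTO.K u))) ∨
      (∃ α : OnePoint ℂ, TTO.IsOfType u AΦ α ∧ TTO.IsOfType u AΨ α)) ∧
    (∀ α : OnePoint ℂ, TTO.IsOfType u AΦ α → TTO.IsOfType u AΨ α →
      TTO.IsOfType u (AΦ ∘L AΨ) α) := by
  have hT : ∀ (T : TTO.K u →L[ℂ] TTO.K u) (ψ ξ : TTO.K u),
      (TTO.modelShift u hu).Rep T ψ ξ → (TTO.modelShift u hu).CSymm T :=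
    fun T ψ ξ h => (TTO.hasSymbol_of_rep h).cSymm hu
  have hcomp : ∀ α : OnePoint ℂ, TTO.IsOfType u AΦ α → TTO.IsOfType u AΨ α →
      TTO.IsOfType u (AΦ ∘L AΨ) α := by
    intro α
    induction α using OnePoint.rec with
    | infty =>
      simp only [TTO.isOfType_infty_iff hu]
      exact TTO.ConjugatedShift.InfiniteType.comp hT
    | coe α =>
      simp only [TTO.isOfType_coe_iff hu]
      exact TTO.ConjugatedShift.FiniteType.comp hT
  refine ⟨⟨fun ⟨Θ, hΘ⟩ => ?_, ?_⟩, hcomp⟩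
  · rcases (hΦ.rep hu).types_of_comp (hΨ.rep hu) (hΦ.cSymm hu) (hΨ.cSymm hu) (hΘ.rep hu) with
      (⟨c, h⟩ | ⟨c, h⟩) | ⟨h1, h2⟩ | ⟨α, h1, h2⟩
    · exact Or.inl (Or.inl ⟨c, TTO.eq_smul_id_of_rep h⟩)
    · exact Or.inl (Or.inr ⟨c, TTO.eq_smul_id_of_rep h⟩)
    · exact Or.inr ⟨OnePoint.infty, (TTO.isOfType_infty_iff hu).2 h1,
        (TTO.isOfType_infty_iff hu).2 h2⟩
    · exact Or.inr ⟨α, (TTO.isOfType_coe_iff hu).2 h1, (TTO.isOfType_coe_iff hu).2 h2⟩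
  · rintro ((⟨c, rfl⟩ | ⟨c, rfl⟩) | ⟨α, h1, h2⟩)
    · exact ⟨c • Ψ, hΨ.smul c⟩
    · refine ⟨c • Φ, ?_⟩
      convert hΦ.smul c using 1
      ext1 x
      exact AΦ.map_smul c x
    · have h := hcomp α h1 h2
      induction α using OnePoint.rec with
      | infty =>
        obtain ⟨ψ, -, hψ⟩ := h
        exact ⟨_, hψ⟩
      | coe α =>
        obtain ⟨φ, c, hφ⟩ := h
        exact ⟨_, hφ⟩
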